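/- Let $K$ be a field, let $m,n\ge 0$, and let $S=K[x_1,\dots,x_m,y_1,\dots,y_n]$ be the standard bigraded polynomial ring, with $\deg x_i=(1,0)$ and $\deg y_j=(0,1)$. Put $Q=(y_1,\dots,y_n)$. For an $S$-module $N$ let $\operatorname{cd}(Q,N)$ be the largest integer $i$ with $H^i_Q(N)\ne 0$ (with $\operatorname{cd}(Q,0)=-\infty$), and let $\operatorname{grade}(Q,N)$ be the supremum of the lengths of $N$-regular sequences contained in $Q$ (with $\operatorname{grade}(Q,0)=\infty$). A module $N$ is called Cohen--Macaulay with respect to $Q$ if $\operatorname{grade}(Q,N)=\operatorname{cd}(Q,N)$. Let $M$ be a finitely generated bigraded ($\mathbb Z^2$-graded) $S$-module. Its unmixed component $u_{Q,M}(0)$ is the largest bigraded submodule $N$ of $M$ with $\operatorname{cd}(Q,N)<\operatorname{cd}(Q,M)$ (that is, the last proper term of the dimension filtration of $M$ with respect to $Q$); for $M=0$ it is $0$. The module $M$ is called approximately Cohen--Macaulay with respect to $Q$ if $M/u_{Q,M}(0)$ is Cohen--Macaulay with respect to $Q$ and $\operatorname{grade}(Q,M)\ge \operatorname{cd}(Q,M)-1$.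 If $M$ is approximately Cohen--Macaulay with respect to $Q$, then (a) $\operatorname{Ass}(u_{Q,M}(0))=\{\mathfrak p\in\operatorname{Ass}(M):\operatorname{cd}(Q,S/\mathfrak p)=\operatorname{cd}(Q,M)-1\}$, and (b) $\operatorname{Ass}(M/u_{Q,M}(0))=\{\mathfrak p\in\operatorname{Ass}(M):\operatorname{cd}(Q,S/\mathfrak p)=\operatorname{cd}(Q,M)\}$. -/

import Mathlib

universe u

/-- The cohomological dimension `cd(I, M)`: the largest `i` with `H^i_I(M) ≠ 0`
(`⊥` if there is none, in particular for `M = 0`). -/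
noncomputable def cohomDim {R : Type u} [CommRing R] (I : Ideal R)
    (M : Type u) [AddCommGroup M] [Module R M] : WithBot ℕ∞ :=
  ⨆ (i : ℕ) (_ : Nontrivial ((localCohomology I i).obj (ModuleCat.of R M))),
    ((i : ℕ∞) : WithBot ℕ∞)

/-- The grade of `I` on `M`: the supremum of the lengths of `M`-regular sequences in `I`.
As usual it is `⊤` if `I M = M` (for finitely generated `M`, in particular for `M = 0`), which is
why the condition `M / (r₁, …, rₖ) M ≠ 0` is not imposed; it holds automatically if `I M ≠ M`. -/
noncomputable def gradeOn {R : Type u} [CommRing R] (I : Ideal R)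
    (M : Type u) [AddCommGroup M] [Module R M] : ℕ∞ :=
  ⨆ (rs : List R) (_ : (∀ r ∈ rs, r ∈ I) ∧ RingTheory.Sequence.IsWeaklyRegular M rs),
    (rs.length : ℕ∞)

/-- `M` is Cohen–Macaulay with respect to `I`: `grade(I, M) = cd(I, M)`. -/
def IsCMWith {R : Type u} [CommRing R] (I : Ideal R)
    (M : Type u) [AddCommGroup M] [Module R M] : Prop :=
  (gradeOn I M : WithBot ℕ∞) = cohomDim I M

/-- The bidegrees of the variables of `K[x₁,…,xₘ,y₁,…,yₙ]`: `deg xᵢ = (1,0)`, `deg yⱼ = (0,1)`. -/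
def bidegree (m n : ℕ) : Fin m ⊕ Fin n → ℤ × ℤ :=
  Sum.elim (fun _ => (1, 0)) (fun _ => (0, 1))

/-- The standard bigrading of `S = K[x₁,…,xₘ,y₁,…,yₙ]`. -/
noncomputable abbrev bigrading (K : Type u) [Field K] (m n : ℕ) :
    ℤ × ℤ → Submodule K (MvPolynomial (Fin m ⊕ Fin n) K) :=
  MvPolynomial.weightedHomogeneousSubmodule K (bidegree m n)

/-- The ideal `Q = (y₁,…,yₙ)` of `S`. -/
noncomputable def idealQ (K : Type u) [Field K] (m n : ℕ) :
    Ideal (MvPolynomial (Fin m ⊕ Fin n) K) :=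
  Ideal.span (Set.range fun j : Fin n => MvPolynomial.X (Sum.inr j))

/-- The unmixed component `u_{I,M}(0)` of a bigraded module `M` with respect to `I`: the largest
bigraded submodule `N` of `M` with `cd(I, N) < cd(I, M)`. -/
noncomputable def unmixedComponent {R : Type u} [CommRing R] (I : Ideal R)
    {M : Type u} [AddCommGroup M] [Module R M]
    (ℳ : ℤ × ℤ → AddSubgroup M) [DirectSum.Decomposition ℳ] : Submodule R M :=
  sSup {N : Submodule R M | N.IsHomogeneous ℳ ∧ cohomDim I N < cohomDim I M}

/-- `0 = D₀ ⊊ D₁ ⊊ ⋯ ⊊ Dᵣ = M` is the dimension filtration of the bigraded module `M` with respect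
to `I`: for each `i ≥ 1`, `Dᵢ₋₁` is the largest bigraded submodule of `Dᵢ` with
`cd(I, Dᵢ₋₁) < cd(I, Dᵢ)`. -/
structure IsDimensionFiltration {R : Type u} [CommRing R] (I : Ideal R)
    {M : Type u} [AddCommGroup M] [Module R M]
    (ℳ : ℤ × ℤ → AddSubgroup M) [DirectSum.Decomposition ℳ]
    {r : ℕ} (D : Fin (r + 1) → Submodule R M) : Prop where
  strictMono : StrictMono D
  zero : D 0 = ⊥
  last : D (Fin.last r) = ⊤
  isGreatest : ∀ i : Fin r,
    IsGreatest {N : Submodule R M |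
      N.IsHomogeneous ℳ ∧ N ≤ D i.succ ∧ cohomDim I N < cohomDim I (D i.succ)} (D i.castSucc)

theorem cohomDim_congr {R : Type u} [CommRing R] (I : Ideal R) {M N : Type u} [AddCommGroup M]
    [Module R M] [AddCommGroup N] [Module R N] (e : M ≃ₗ[R] N) :
    cohomDim I M = cohomDim I N := by
  have h (i : ℕ) : Nontrivial ((localCohomology I i).obj (ModuleCat.of R M)) ↔
      Nontrivial ((localCohomology I i).obj (ModuleCat.of R N)) :=
    (((localCohomology I i).mapIso e.toModuleIso).toLinearEquiv.toEquiv).nontrivial_congr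
  simp only [cohomDim, h]

/-- The unmixed component is the last proper term `D_{r-1}` of the dimension filtration. -/
theorem IsDimensionFiltration.eq_unmixedComponent {R : Type u} [CommRing R] {I : Ideal R}
    {M : Type u} [AddCommGroup M] [Module R M]
    {ℳ : ℤ × ℤ → AddSubgroup M} [DirectSum.Decomposition ℳ]
    {r : ℕ} {D : Fin (r + 1 + 1) → Submodule R M} (hD : IsDimensionFiltration I ℳ D) :
    D (Fin.last r).castSucc = unmixedComponent I ℳ := by
  have h := hD.isGreatest (Fin.last r)
  rw [Fin.succ_last, hD.last, cohomDim_congr I Submodule.topEquiv] at h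
  simp only [le_top, true_and] at h
  exact h.isLUB.sSup_eq.symm

/-- The bigraded module `M` is approximately Cohen–Macaulay with respect to `I`: `M / u_{I,M}(0)`
is Cohen–Macaulay with respect to `I` and `grade(I, M) ≥ cd(I, M) - 1`. -/
def IsApproxCMWith {R : Type u} [CommRing R] (I : Ideal R)
    {M : Type u} [AddCommGroup M] [Module R M]
    (ℳ : ℤ × ℤ → AddSubgroup M) [DirectSum.Decomposition ℳ] : Prop :=
  IsCMWith I (M ⧸ unmixedComponent I ℳ) ∧
    cohomDim I M ≤ (gradeOn I M : WithBot ℕ∞) + 1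

/-! Write U for the unmixed component and c for cd(Q, M). The theorem is a squeeze. For a finitely
generated N and a bigraded prime p in Ass(N), grade(Q, N) ≤ cd(Q, S/p) ≤ cd(Q, N). If p is in
Ass(M/U), then cd(M/U) = c by the long exact sequence, and the Cohen–Macaulay property forces
cd(S/p) = c. If p is in Ass(U), it is also in Ass(M), so c - 1 ≤ grade(Q, M) ≤ cd(S/p) ≤ cd(U) < c.
Since Ass(M) lies in Ass(U) ∪ Ass(M/U), the two values of cd separate the primes. Finally Ass(M/U)
lies in Ass(M): a prime with cd(S/p) = c is outside Supp(U), because cd(U) < c.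

The right inequality holds for every p in Supp(N) over a Noetherian ring with bounded local
cohomology (`CohomDimLT.quotient_of_mem_support`). The left one goes through the number d of
homogeneous parameters of K[y]/(p ∩ K[y]) (`exists_parameter_number`). On one side, an N-regular
sequence in Q yields a chain of primes from p to a minimal prime of p plus d parameters, so its
length is at most d by Krull's height theorem. On the other side, graded Noether normalization makes
K[y]/(p ∩ K[y]) finite and faithful over a polynomial ring in d variables; this contradicts the
condition that vanishing of H^d_Q would impose (`LocalCohomologyVanishes.exists_prod_pow_smul_mem`).

Local cohomology is used only through its vanishing, phrased as the death of Ext classes along R/I^s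
→ R/I^t. -/

section

/-! ### Vanishing of local cohomology in terms of Ext classes. -/

open CategoryTheory Limits Opposite Abelian

namespace CategoryTheory.ProjectiveResolution

variable {R : Type u} [CommRing R] {X : ModuleCat.{u} R}

/-- The functor whose left derived functors compute `Ext`. -/
noncomputable abbrev extFunctor (Y : ModuleCat.{u} R) : ModuleCat.{u} R ⥤ (ModuleCat.{u} R)ᵒᵖ :=
  ((linearYoneda R (ModuleCat.{u} R)).obj Y).rightOp

/-- The complex whose homology computes `Ext`. -/
noncomputable abbrev extComplex (P : ProjectiveResolution X) (Y : ModuleCat.{u} R) :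
    ChainComplex (ModuleCat.{u} R)ᵒᵖ ℕ :=
  ((extFunctor Y).mapHomologicalComplex _).obj P.complex

/-- The cochain `z` represents the class `e` in the homology of `P.extComplex Y`. -/
def Represents (P : ProjectiveResolution X) {Y : ModuleCat.{u} R} {n : ℕ}
    (z : P.complex.X n ⟶ Y) (e : ((P.extComplex Y).homology n).unop) : Prop :=
  ∃ o : ((P.extComplex Y).opcycles n).unop,
    ((P.extComplex Y).homologyι n).unop o = e ∧ ((P.extComplex Y).pOpcycles n).unop o = z

theorem exists_represents (P : ProjectiveResolution X) {Y : ModuleCat.{u} R} {n : ℕ}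
    (e : ((P.extComplex Y).homology n).unop) :
    ∃ z : P.complex.X n ⟶ Y, P.complex.d (n + 1) n ≫ z = 0 ∧ P.Represents z e := by
  obtain ⟨o, ho⟩ := (ModuleCat.epi_iff_surjective ((P.extComplex Y).homologyι n).unop).1
    inferInstance e
  refine ⟨((P.extComplex Y).pOpcycles n).unop o, ?_, o, ho, rfl⟩
  have h := (P.extComplex Y).d_pOpcycles (n + 1) n
  have h2 := congrArg (fun f => f.unop o) h
  exact h2

/-- The complex lives in the opposite category, so its opcycles are the cocycles and `homologyι`
becomes the projection of cocycles onto cohomology. Exactness there identifies the kernel with the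
coboundaries. -/
theorem Represents.eq_zero_iff {P : ProjectiveResolution X} {Y : ModuleCat.{u} R} {n p : ℕ}
    (hp : p + 1 = n) {z : P.complex.X n ⟶ Y} {e : ((P.extComplex Y).homology n).unop}
    (h : P.Represents z e) : e = 0 ↔ ∃ w : P.complex.X p ⟶ Y, P.complex.d n p ≫ w = z := by
  obtain ⟨o, rfl, rfl⟩ := h
  have hex : (ShortComplex.mk _ _ ((P.extComplex Y).homologyι_comp_fromOpcycles n p)).Exact :=
    ShortComplex.exact_of_f_is_kernel _
      ((P.extComplex Y).homologyIsKernel n p (by subst hp; exact ChainComplex.next_nat_succ p))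
  have hex' := (ShortComplex.ShortExact.moduleCat_exact_iff_function_exact _).1 hex.unop
  have hinj := (ModuleCat.mono_iff_injective ((P.extComplex Y).pOpcycles n).unop).1 inferInstance
  have hd : ∀ w : P.complex.X p ⟶ Y, ((P.extComplex Y).pOpcycles n).unop
      (((P.extComplex Y).fromOpcycles n p).unop w) = P.complex.d n p ≫ w := fun w =>
    congrArg (fun f => f.unop w) ((P.extComplex Y).p_fromOpcycles n p)
  constructor
  · intro h0
    obtain ⟨w, hw⟩ := (hex' o).1 h0
    exact ⟨w, (hd w).symm.trans (congrArg ((P.extComplex Y).pOpcycles n).unop hw)⟩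
  · rintro ⟨w, hw⟩
    refine (hex' o).2 ⟨w, hinj ?_⟩
    exact (hd w).trans hw

theorem Represents.eq_zero_iff_zero {P : ProjectiveResolution X} {Y : ModuleCat.{u} R}
    {z : P.complex.X 0 ⟶ Y} {e : ((P.extComplex Y).homology 0).unop}
    (h : P.Represents z e) : e = 0 ↔ z = 0 := by
  obtain ⟨o, rfl, rfl⟩ := h
  have hinj := (ModuleCat.mono_iff_injective ((P.extComplex Y).pOpcycles 0).unop).1 inferInstance
  have hinj' := (ModuleCat.mono_iff_injective ((P.extComplex Y).homologyι 0).unop).1 inferInstance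
  exact (map_eq_zero_iff _ hinj').trans (map_eq_zero_iff _ hinj).symm

theorem Represents.map {X' : ModuleCat.{u} R} {P : ProjectiveResolution X}
    {P' : ProjectiveResolution X'} {Y : ModuleCat.{u} R} {n : ℕ}
    {z : P.complex.X n ⟶ Y} {e : ((P.extComplex Y).homology n).unop}
    (h : P.Represents z e) (φ : P'.complex ⟶ P.complex) :
    P'.Represents (φ.f n ≫ z) ((HomologicalComplex.homologyMap
      (((extFunctor Y).mapHomologicalComplex _).map φ) n).unop e) := by
  obtain ⟨o, rfl, rfl⟩ := h
  refine ⟨(HomologicalComplex.opcyclesMap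
    (((extFunctor Y).mapHomologicalComplex _).map φ) n).unop o, ?_, ?_⟩
  · exact (congrArg (fun f => f.unop o) (HomologicalComplex.homologyι_naturality
      (((extFunctor Y).mapHomologicalComplex _).map φ) n)).symm
  · exact (congrArg (fun f => f.unop o) (HomologicalComplex.p_opcyclesMap
      (((extFunctor Y).mapHomologicalComplex _).map φ) n))

theorem extMk_zero_eq_zero_iff (P : ProjectiveResolution X) {Y : ModuleCat.{u} R}
    (z : P.complex.X 0 ⟶ Y) (hz : P.complex.d 1 0 ≫ z = 0) :
    P.extMk z 1 rfl hz = 0 ↔ z = 0 := by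
  rw [← P.extEquivCohomologyClass.apply_eq_iff_eq, extEquivCohomologyClass_extMk,
    extEquivCohomologyClass_zero, CochainComplex.HomComplex.CohomologyClass.mk_eq_zero_iff,
    CochainComplex.HomComplex.Cocycle.toSingleMk_mem_coboundaries_iff _ _ _ _ _ 1 (by simp)]
  have h0 : IsZero (P.cochainComplex.X 1) := P.cochainComplex.isZero_of_isStrictlyLE 0 1 (by simp)
  constructor
  · rintro ⟨g, hg⟩
    rw [h0.eq_zero_of_src g, comp_zero] at hg
    rw [← cancel_epi (P.cochainComplexXIso (-(0 : ℕ)) 0 rfl).hom, ← hg, comp_zero]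
  · rintro rfl
    exact ⟨0, by simp⟩

/-- The homology class in `((Ext R C n).obj (op X)).obj Y` is computed by `P`. -/
noncomputable def extIso (P : ProjectiveResolution X) (Y : ModuleCat.{u} R) (n : ℕ) :
    ((Ext R (ModuleCat.{u} R) n).obj (op X)).obj Y ≅ ((P.extComplex Y).homology n).unop :=
  (P.isoLeftDerivedObj (extFunctor Y) n).unop.symm

theorem extIso_naturality {X' : ModuleCat.{u} R} (P : ProjectiveResolution X)
    (P' : ProjectiveResolution X') (Y : ModuleCat.{u} R) (n : ℕ) {f : X' ⟶ X} (φ : P'.Hom P f)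
    (e : ((Ext R (ModuleCat.{u} R) n).obj (op X)).obj Y) :
    (P'.extIso Y n).hom (((Ext R (ModuleCat.{u} R) n).map f.op).app Y e) =
      (HomologicalComplex.homologyMap
        (((extFunctor Y).mapHomologicalComplex _).map φ.hom) n).unop ((P.extIso Y n).hom e) := by
  have h := ProjectiveResolution.isoLeftDerivedObj_inv_naturality f P' P φ.hom
    (by simpa using φ.hom_f_zero_comp_π_f_zero) (extFunctor Y) n
  exact congrArg (fun g => g.unop e) h

theorem hom_nonempty {X' : ModuleCat.{u} R} (P : ProjectiveResolution X)
    (P' : ProjectiveResolution X') (f : X' ⟶ X) : Nonempty (P'.Hom P f) :=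
  ⟨{ hom := ProjectiveResolution.lift f P' P
     hom_f_zero_comp_π_f_zero := by
      have h := ProjectiveResolution.lift_commutes_zero f P' P
      simpa using h }⟩

/-- Ext as a derived functor and Ext in the derived category are compared only through vanishing: on
both sides a class pulls back to zero exactly when the same pulled-back cocycle is a coboundary. No
natural isomorphism between the two is needed. -/
theorem Represents.map_eq_zero_iff {X' : ModuleCat.{u} R} {P : ProjectiveResolution X}
    {P' : ProjectiveResolution X'} {Y : ModuleCat.{u} R} {n : ℕ} {f : X' ⟶ X}
    (z : P.complex.X n ⟶ Y) (hz : P.complex.d (n + 1) n ≫ z = 0)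
    (e : ((Ext R (ModuleCat.{u} R) n).obj (op X)).obj Y)
    (h : P.Represents z ((P.extIso Y n).hom e)) :
    ((Ext R (ModuleCat.{u} R) n).map f.op).app Y e = 0 ↔
      (Ext.mk₀ f).comp (P.extMk z (n + 1) rfl hz) (zero_add n) = 0 := by
  obtain ⟨φ⟩ := hom_nonempty P P' f
  rw [mk₀_comp_extMk z (n + 1) rfl hz φ]
  have h' := h.map φ.hom
  rw [← extIso_naturality] at h'
  have hinj := (ModuleCat.mono_iff_injective (P'.extIso Y n).hom).1 inferInstance
  rw [← _root_.map_eq_zero_iff _ hinj]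
  cases n with
  | zero => rw [h'.eq_zero_iff_zero, extMk_zero_eq_zero_iff]
  | succ p => rw [h'.eq_zero_iff rfl, extMk_eq_zero_iff _ _ _ _ _ p rfl]

theorem represents_of_cocycle (P : ProjectiveResolution X) {Y : ModuleCat.{u} R} {n : ℕ}
    (z : P.complex.X n ⟶ Y) (hz : P.complex.d (n + 1) n ≫ z = 0) :
    ∃ e : ((P.extComplex Y).homology n).unop, P.Represents z e := by
  have hw : (P.extComplex Y).d (n + 1) n ≫ Quiver.Hom.op
      (ModuleCat.ofHom (LinearMap.toSpanSingleton R (P.complex.X n ⟶ Y) z)) = 0 := by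
    apply Quiver.Hom.unop_inj
    ext
    refine Eq.trans ?_ hz
    exact congrArg (P.complex.d (n + 1) n ≫ ·) (one_smul R z)
  -- The cocycle is encoded as the linear map from `R` sending 1 to `z`; it lifts to the cocycles,
  -- and the lift is evaluated at 1.
  let l := (P.extComplex Y).descOpcycles _ (n + 1) (by simp) hw
  refine ⟨_, l.unop 1, rfl, ?_⟩
  have h := (P.extComplex Y).p_descOpcycles _ (n + 1) (by simp) hw
  exact (congrArg (fun g => g.unop (1 : R)) h).trans (one_smul R z)

end CategoryTheory.ProjectiveResolution

open CategoryTheory.ProjectiveResolution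

/-- The transition map `R / J → R / I` for `J ≤ I`. -/
noncomputable def Ideal.quotientTransition {R : Type u} [CommRing R] {I J : Ideal R} (h : J ≤ I) :
    ModuleCat.of R (R ⧸ J) ⟶ ModuleCat.of R (R ⧸ I) :=
  ModuleCat.ofHom (Submodule.mapQ J I LinearMap.id h)

/-- The local cohomology `H^i_I(M)` vanishes: each class in `Ext^i(R / I^t, M)` dies in
`Ext^i(R / I^s, M)` for some `s ≥ t`. -/
def LocalCohomologyVanishes {R : Type u} [CommRing R] (I : Ideal R) (i : ℕ)
    (M : Type u) [AddCommGroup M] [Module R M] : Prop :=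
  ∀ (t : ℕ) (e : Ext (ModuleCat.of R (R ⧸ I ^ t)) (ModuleCat.of R M) i),
    ∃ (s : ℕ) (h : t ≤ s),
      (Ext.mk₀ (Ideal.quotientTransition (Ideal.pow_le_pow_right (I := I) h))).comp e
        (zero_add i) = 0

/-- Local cohomology is a filtered colimit of Ext modules, and such a colimit is zero exactly when
each element dies at a later stage. -/
theorem localCohomology_subsingleton_iff_forall {R : Type u} [CommRing R] (I : Ideal R) (i : ℕ)
    (M : ModuleCat.{u} R) :
    Subsingleton ((localCohomology I i).obj M) ↔
      ∀ (t : ℕ) (e : ((Ext R (ModuleCat.{u} R) i).obj (op (ModuleCat.of R (R ⧸ I ^ t)))).obj M),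
        ∃ (s : ℕ) (h : t ≤ s),
          ((Ext R (ModuleCat.{u} R) i).map (Ideal.quotientTransition
            (Ideal.pow_le_pow_right (I := I) h)).op).app M e = 0 := by
  let D := localCohomology.diagram (localCohomology.idealPowersDiagram I) i
  let F : ℕᵒᵖᵒᵖ ⥤ ModuleCat.{u} R := D ⋙ (evaluation _ _).obj M
  have e : (localCohomology I i).obj M ≅ colimit F := colimitObjIsoColimitCompEvaluation D M
  have : PreservesFilteredColimitsOfSize.{0, 0} (forget (ModuleCat.{u} R)) :=
    preservesFilteredColimitsOfSize_shrink.{0, u, 0, u} _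
  rw [e.toLinearEquiv.toEquiv.subsingleton_congr]
  constructor
  · intro hs t x
    obtain ⟨j, f, hf⟩ := Concrete.colimit_rep_eq_zero R F (op (op t)) x (Subsingleton.elim _ _)
    exact ⟨j.unop.unop, f.unop.unop.down.down, hf⟩
  · intro h
    refine subsingleton_of_forall_eq 0 fun y => ?_
    obtain ⟨j, x, rfl⟩ := Concrete.colimit_exists_rep F y
    obtain ⟨s, hs, hx⟩ := h j.unop.unop x
    have hw := colimit.w F (show j ⟶ op (op s) from (homOfLE hs).op.op)
    rw [← hw]
    refine (congrArg (colimit.ι F (op (op s))) ?_).trans (map_zero _)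
    exact hx

theorem localCohomology_subsingleton_iff {R : Type u} [CommRing R] (I : Ideal R) (i : ℕ)
    (M : Type u) [AddCommGroup M] [Module R M] :
    Subsingleton ((localCohomology I i).obj (ModuleCat.of R M)) ↔
      LocalCohomologyVanishes I i M := by
  rw [localCohomology_subsingleton_iff_forall]
  refine forall_congr' fun t => ?_
  let P (s : ℕ) := projectiveResolution (ModuleCat.of R (R ⧸ I ^ s))
  constructor
  · intro H e
    obtain ⟨z, hz, rfl⟩ := (P t).extMk_surjective e (i + 1) rfl
    obtain ⟨e', he'⟩ := (P t).represents_of_cocycle z hz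
    obtain ⟨e'', rfl⟩ :=
      (ModuleCat.epi_iff_surjective ((P t).extIso (ModuleCat.of R M) i).hom).1 inferInstance e'
    obtain ⟨s, hs, h⟩ := H e''
    exact ⟨s, hs, (Represents.map_eq_zero_iff (P' := P s) z hz e'' he').1 h⟩
  · intro H e
    obtain ⟨z, hz, hr⟩ := (P t).exists_represents (((P t).extIso (ModuleCat.of R M) i).hom e)
    obtain ⟨s, hs, h⟩ := H ((P t).extMk z (i + 1) rfl hz)
    exact ⟨s, hs, (Represents.map_eq_zero_iff (P' := P s) z hz e hr).2 h⟩

end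

/-! ### Long exact sequences, and acyclicity of power-torsion modules. -/

section

open CategoryTheory Limits Opposite Abelian

namespace LocalCohomologyVanishes

variable {R : Type u} [CommRing R] {I : Ideal R}

/-- Restriction of an extension class along `R / I^s → R / I^t`. -/
noncomputable def res (I : Ideal R) {s t : ℕ} (h : t ≤ s) {M : ModuleCat.{u} R} {i : ℕ}
    (e : Ext (ModuleCat.of R (R ⧸ I ^ t)) M i) : Ext (ModuleCat.of R (R ⧸ I ^ s)) M i :=
  (Ext.mk₀ (Ideal.quotientTransition (Ideal.pow_le_pow_right (I := I) h))).comp e (zero_add i)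

theorem res_res {s t r : ℕ} (h : t ≤ s) (h' : s ≤ r) {M : ModuleCat.{u} R} {i : ℕ}
    (e : Ext (ModuleCat.of R (R ⧸ I ^ t)) M i) :
    res I h' (res I h e) = res I (h.trans h') e := by
  unfold res
  rw [← Ext.comp_assoc _ _ _ (zero_add 0) (zero_add i) (by omega), Ext.mk₀_comp_mk₀]
  congr 2
  ext
  rfl

theorem res_comp {s t : ℕ} (h : t ≤ s) {M N : ModuleCat.{u} R} {i j k : ℕ}
    (e : Ext (ModuleCat.of R (R ⧸ I ^ t)) M i) (e' : Ext M N j) (hk : i + j = k) :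
    res I h (e.comp e' hk) = (res I h e).comp e' hk := by
  unfold res
  rw [Ext.comp_assoc _ _ _ (zero_add i) hk (by omega)]

section Exact

variable {A B C : Type u} [AddCommGroup A] [Module R A] [AddCommGroup B] [Module R B]
  [AddCommGroup C] [Module R C] {f : A →ₗ[R] B} {g : B →ₗ[R] C}

/-- The short complex attached to two composable linear maps. -/
abbrev shortComplex (h : Function.Exact f g) : ShortComplex (ModuleCat.{u} R) :=
  ShortComplex.mk (ModuleCat.ofHom f) (ModuleCat.ofHom g) (by
    ext x; exact h.apply_apply_eq_zero x)

theorem shortExact (hf : Function.Injective f) (h : Function.Exact f g)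
    (hg : Function.Surjective g) : (shortComplex h).ShortExact where
  exact := (ShortComplex.ShortExact.moduleCat_exact_iff_function_exact _).2 h
  mono_f := (ModuleCat.mono_iff_injective _).2 hf
  epi_g := (ModuleCat.epi_iff_surjective _).2 hg

/-- The image of a class in C dies at some stage, where the class comes from A; that preimage dies
at a still later stage. The two variants below use the same argument at the other places of the long
exact sequence. -/
theorem of_exact (hf : Function.Injective f) (h : Function.Exact f g)
    (hg : Function.Surjective g) {i : ℕ} (hA : LocalCohomologyVanishes I i A)
    (hC : LocalCohomologyVanishes I i C) : LocalCohomologyVanishes I i B := by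
  intro t e
  have hS := shortExact hf h hg
  obtain ⟨s, hs, h1⟩ := hC t (e.comp (Ext.mk₀ (shortComplex h).g) (add_zero i))
  change res I hs _ = 0 at h1
  rw [res_comp] at h1
  obtain ⟨a, ha⟩ := Ext.covariant_sequence_exact₂ _ hS _ h1
  obtain ⟨r, hr, h2⟩ := hA s a
  refine ⟨r, hs.trans hr, ?_⟩
  change res I (hs.trans hr) e = 0
  change res I hr a = 0 at h2
  rw [← res_res hs hr, ← ha, res_comp, h2, Ext.zero_comp]

theorem of_exact_right (hf : Function.Injective f) (h : Function.Exact f g)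
    (hg : Function.Surjective g) {i : ℕ} (hB : LocalCohomologyVanishes I i B)
    (hA : LocalCohomologyVanishes I (i + 1) A) : LocalCohomologyVanishes I i C := by
  intro t e
  have hS := shortExact hf h hg
  obtain ⟨s, hs, h1⟩ := hA t (e.comp hS.extClass rfl)
  change res I hs _ = 0 at h1
  rw [res_comp] at h1
  obtain ⟨a, ha⟩ := Ext.covariant_sequence_exact₃ _ hS _ rfl h1
  obtain ⟨r, hr, h2⟩ := hB s a
  refine ⟨r, hs.trans hr, ?_⟩
  change res I (hs.trans hr) e = 0
  change res I hr a = 0 at h2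
  rw [← res_res hs hr, ← ha, res_comp, h2, Ext.zero_comp]

theorem of_exact_left (hf : Function.Injective f) (h : Function.Exact f g)
    (hg : Function.Surjective g) {i : ℕ} (hC : LocalCohomologyVanishes I i C)
    (hB : LocalCohomologyVanishes I (i + 1) B) : LocalCohomologyVanishes I (i + 1) A := by
  intro t e
  have hS := shortExact hf h hg
  obtain ⟨s, hs, h1⟩ := hB t (e.comp (Ext.mk₀ (shortComplex h).f) (add_zero _))
  change res I hs _ = 0 at h1
  rw [res_comp] at h1
  obtain ⟨a, ha⟩ := Ext.covariant_sequence_exact₁ _ hS _ h1 rfl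
  obtain ⟨r, hr, h2⟩ := hC s a
  refine ⟨r, hs.trans hr, ?_⟩
  change res I (hs.trans hr) e = 0
  change res I hr a = 0 at h2
  rw [← res_res hs hr, ← ha, res_comp, h2, Ext.zero_comp]

end Exact

variable {M N : Type u} [AddCommGroup M] [Module R M] [AddCommGroup N] [Module R N]

theorem of_subsingleton [Subsingleton M] (i : ℕ) : LocalCohomologyVanishes I i M := by
  intro t e
  refine ⟨t, le_rfl, ?_⟩
  have h : IsZero (ModuleCat.of R M) := ModuleCat.isZero_of_subsingleton _
  have : Ext.mk₀ (𝟙 (ModuleCat.of R M)) = 0 := by rw [h.eq_of_src (𝟙 _) 0, Ext.mk₀_zero]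
  rw [← Ext.comp_mk₀_id e, this, Ext.comp_zero, Ext.comp_zero]

theorem congr (e : M ≃ₗ[R] N) {i : ℕ} (h : LocalCohomologyVanishes I i M) :
    LocalCohomologyVanishes I i N :=
  of_exact (f := e.toLinearMap) (g := (0 : N →ₗ[R] PUnit.{u + 1})) e.injective
    (fun x => ⟨fun _ => e.surjective x, fun _ => rfl⟩) (fun _ => ⟨0, rfl⟩) h (of_subsingleton i)

theorem eq_zero_of_pow_smul_eq_zero (h : LocalCohomologyVanishes I 0 M) {t : ℕ} {x : M}
    (hx : ∀ r ∈ I ^ t, r • x = 0) : x = 0 := by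
  let φ : (R ⧸ I ^ t) →ₗ[R] M := Submodule.liftQ _ (LinearMap.toSpanSingleton R M x) hx
  obtain ⟨s, hs, h0⟩ := h t (Ext.mk₀ (ModuleCat.ofHom φ))
  rw [Ext.mk₀_comp_mk₀, Ext.mk₀_eq_zero_iff] at h0
  have := congrArg (fun g => g.hom (Submodule.Quotient.mk 1)) h0
  exact (one_smul R x).symm.trans this

/-- On Ext(R/I^t, M) the element a^t acts as zero through the first argument and invertibly through
the second. -/
theorem of_smul_bijective {a : R} (ha : a ∈ I)
    (h : Function.Bijective (LinearMap.lsmul R M a)) (i : ℕ) :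
    LocalCohomologyVanishes I i M := by
  intro t e
  refine ⟨t, le_rfl, ?_⟩
  suffices e = 0 by rw [this, Ext.comp_zero]
  have h1 : a ^ t • e = 0 := by
    have h2 : a ^ t • 𝟙 (ModuleCat.of R (R ⧸ I ^ t)) = 0 := by
      ext
      exact (Submodule.Quotient.mk_eq_zero _).2
        (Ideal.mul_mem_right _ _ (Ideal.pow_mem_pow ha t))
    have h3 := Ext.smul_comp (Ext.mk₀ (𝟙 (ModuleCat.of R (R ⧸ I ^ t)))) e (zero_add i) (a ^ t)
    rw [← Ext.mk₀_smul, h2, Ext.mk₀_zero, Ext.zero_comp, Ext.mk₀_id_comp] at h3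
    exact h3.symm
  have hb : Function.Bijective (a ^ t • 𝟙 (ModuleCat.of R M) : _ ⟶ _) := by
    have : ⇑(a ^ t • 𝟙 (ModuleCat.of R M) : ModuleCat.of R M ⟶ _) =
        (LinearMap.lsmul R M a)^[t] := by
      funext x
      change a ^ t • x = _
      clear h1 e
      induction t generalizing x with
      | zero => simp
      | succ t ih => rw [Function.iterate_succ_apply, ← ih, pow_succ, mul_smul]; rfl
    rw [this]
    exact h.iterate t
  have : IsIso (a ^ t • 𝟙 (ModuleCat.of R M)) :=
    (ConcreteCategory.isIso_iff_bijective _).2 hb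
  rw [Ext.smul_eq_comp_mk₀] at h1
  have h4 := congrArg (fun y => Ext.comp y (Ext.mk₀ (inv (a ^ t • 𝟙 (ModuleCat.of R M))))
    (add_zero i)) h1
  rwa [Ext.zero_comp, Ext.comp_assoc _ _ _ (add_zero i) (zero_add 0) (by omega),
    Ext.mk₀_comp_mk₀, IsIso.hom_inv_id, Ext.comp_mk₀_id] at h4

end LocalCohomologyVanishes

/-- The submodule of elements killed by a power of `I`. -/
def powerTorsion {R : Type*} [CommRing R] (I : Ideal R) (M : Type*) [AddCommGroup M] [Module R M] :
    Submodule R M where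
  carrier := {x | ∃ k : ℕ, ∀ r ∈ I ^ k, r • x = 0}
  zero_mem' := ⟨0, fun _ _ => smul_zero _⟩
  add_mem' := by
    rintro x y ⟨k, hk⟩ ⟨l, hl⟩
    refine ⟨max k l, fun r hr => ?_⟩
    rw [smul_add, hk r (Ideal.pow_le_pow_right (le_max_left k l) hr),
      hl r (Ideal.pow_le_pow_right (le_max_right k l) hr), add_zero]
  smul_mem' := by
    rintro a x ⟨k, hk⟩
    exact ⟨k, fun r hr => by rw [smul_comm, hk r hr, smul_zero]⟩

theorem powerTorsion_exists_uniform {R : Type*} [CommRing R] {I : Ideal R} {M : Type*}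
    [AddCommGroup M] [Module R M] {N : Submodule R M} (hN : N.FG) (h : N ≤ powerTorsion I M) :
    ∃ k : ℕ, ∀ x ∈ N, ∀ r ∈ I ^ k, r • x = 0 := by
  induction N, hN using Submodule.fg_induction with
  | singleton x =>
    obtain ⟨k, hk⟩ := h (Submodule.mem_span_singleton_self x)
    refine ⟨k, fun y hy r hr => ?_⟩
    obtain ⟨a, rfl⟩ := Submodule.mem_span_singleton.1 hy
    rw [smul_comm, hk r hr, smul_zero]
  | sup N₁ N₂ _ _ h₁ h₂ =>
    obtain ⟨k, hk⟩ := h₁ (le_sup_left.trans h)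
    obtain ⟨l, hl⟩ := h₂ (le_sup_right.trans h)
    refine ⟨max k l, fun x hx r hr => ?_⟩
    obtain ⟨y, hy, z, hz, rfl⟩ := Submodule.mem_sup.1 hx
    rw [smul_add, hk y hy r (Ideal.pow_le_pow_right (le_max_left k l) hr),
      hl z hz r (Ideal.pow_le_pow_right (le_max_right k l) hr), add_zero]

/-- Over a Noetherian ring the `I`-power torsion of an injective module is injective. -/
theorem Module.Injective.powerTorsion {R : Type u} [CommRing R] [IsNoetherianRing R]
    (I : Ideal R) (E : Type u) [AddCommGroup E] [Module R E] [Module.Injective R E] :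
    Module.Injective R (powerTorsion I E) := by
  apply Module.Baer.injective
  intro 𝔞 g
  obtain ⟨k, hk⟩ : ∃ k : ℕ, ∀ x ∈ LinearMap.range ((_root_.powerTorsion I E).subtype ∘ₗ g),
      ∀ r ∈ I ^ k, r • x = 0 := by
    apply powerTorsion_exists_uniform
    · exact Submodule.FG.of_finite
    · rintro _ ⟨x, rfl⟩
      exact (g x).2
  -- Artin–Rees: `g` kills I^k 𝔞, hence I^(k+l) ∩ 𝔞, so it factors through the image of 𝔞 in
  -- R/I^(k+l). Extending from there, rather than from 𝔞, forces the values of the extension to be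
  -- power torsion.
  obtain ⟨l, hl⟩ := Ideal.exists_pow_inf_eq_pow_smul I (𝔞 : Submodule R R)
  have hle : I ^ (k + l) ⊓ 𝔞 ≤ I ^ k * 𝔞 := by
    have := hl (k + l) (by omega)
    simp only [smul_eq_mul, Ideal.mul_top, Nat.add_sub_cancel] at this
    rw [this]
    exact Ideal.mul_mono_right inf_le_right
  let n := k + l
  let π : 𝔞 →ₗ[R] R ⧸ I ^ n := (Submodule.mkQ (I ^ n)) ∘ₗ 𝔞.subtype
  have hker : LinearMap.ker π ≤ LinearMap.ker ((_root_.powerTorsion I E).subtype ∘ₗ g) := by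
    rintro ⟨x, hx⟩ hxn
    have hxn' : x ∈ I ^ n := (Submodule.Quotient.mk_eq_zero _).1 hxn
    have key : ∀ y ∈ I ^ k * 𝔞, ∃ hy : y ∈ 𝔞,
        ((_root_.powerTorsion I E).subtype ∘ₗ g) ⟨y, hy⟩ = 0 := by
      intro y hy
      refine Submodule.mul_induction_on hy ?_ ?_
      · intro r hr a ha
        refine ⟨𝔞.mul_mem_left r ha, ?_⟩
        have : (⟨r * a, 𝔞.mul_mem_left r ha⟩ : 𝔞) = r • ⟨a, ha⟩ := rfl
        rw [this, map_smul]
        exact hk _ ⟨_, rfl⟩ r hr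
      · rintro y z ⟨hy, hy'⟩ ⟨hz, hz'⟩
        refine ⟨𝔞.add_mem hy hz, ?_⟩
        have : (⟨y + z, 𝔞.add_mem hy hz⟩ : 𝔞) = ⟨y, hy⟩ + ⟨z, hz⟩ := rfl
        rw [this, map_add, hy', hz', add_zero]
    exact (key x (hle ⟨hxn', hx⟩)).2
  obtain ⟨h, hh⟩ := Module.Injective.out (R := R) (Q := E)
    ((LinearMap.ker π).liftQ π le_rfl)
    (LinearMap.ker_eq_bot.1 (Submodule.ker_liftQ_eq_bot _ _ _ le_rfl))
    ((LinearMap.ker π).liftQ _ hker)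
  refine ⟨(h ∘ₗ Submodule.mkQ (I ^ n)).codRestrict _ fun x => ⟨n, fun r hr => ?_⟩, ?_⟩
  · rw [← map_smul]
    have : r • x ∈ I ^ n := Ideal.mul_mem_right _ _ hr
    rw [LinearMap.comp_apply, Submodule.mkQ_apply, (Submodule.Quotient.mk_eq_zero _).2 this,
      map_zero]
  · intro x hx
    apply Subtype.ext
    exact hh (Submodule.Quotient.mk ⟨x, hx⟩)

theorem Module.exists_injective_embedding (R : Type u) [CommRing R] (M : Type u) [AddCommGroup M]
    [Module R M] : ∃ (E : Type u) (_ : AddCommGroup E) (_ : Module R E) (_ : Module.Injective R E)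
      (f : M →ₗ[R] E), Function.Injective f := by
  let p := (EnoughInjectives.presentation (ModuleCat.of R M)).some
  have : CategoryTheory.Injective p.J := p.injective
  refine ⟨p.J, inferInstance, inferInstance, ?_, p.f.hom,
    (ModuleCat.mono_iff_injective _).1 p.mono⟩
  have : CategoryTheory.Injective (ModuleCat.of R p.J) := this
  exact Module.injective_module_of_injective_object R p.J

/-- M embeds in the power torsion J of an injective module, which is again injective. A class in
Ext^1 comes from a map R/I^t → J/M; a lift of the image of 1 to J is killed by some I^k, so the map
lifts to J after restriction and the class dies. Higher degrees follow by dimension shifting, as J/M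
is again power torsion. -/
theorem LocalCohomologyVanishes.of_powerTorsion_eq_top {R : Type u} [CommRing R]
    [IsNoetherianRing R] {I : Ideal R} {M : Type u} [AddCommGroup M] [Module R M]
    (hM : powerTorsion I M = ⊤) (i : ℕ) : LocalCohomologyVanishes I (i + 1) M := by
  induction i using Nat.strong_induction_on generalizing M with | _ i ih =>
  obtain ⟨E, _, _, _, ι, hι⟩ := Module.exists_injective_embedding R M
  let J := powerTorsion I E
  have hJ : Module.Injective R J := Module.Injective.powerTorsion I E
  have hJ' : CategoryTheory.Injective (ModuleCat.of R J) :=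
    Module.injective_object_of_injective_module R J
  let f : M →ₗ[R] J := ι.codRestrict _ fun x => by
    obtain ⟨k, hk⟩ : x ∈ powerTorsion I M := hM ▸ Submodule.mem_top
    exact ⟨k, fun r hr => by rw [← map_smul, hk r hr, map_zero]⟩
  have hf : Function.Injective f := fun x y h => hι (congrArg Subtype.val h)
  have hex : Function.Exact f (LinearMap.range f).mkQ := LinearMap.exact_map_mkQ_range f
  have hg := (LinearMap.range f).mkQ_surjective
  cases i with
  | zero =>
    intro t e
    have hS := shortExact hf hex hg
    obtain ⟨c, hc⟩ := Ext.covariant_sequence_exact₁ _ hS e (Ext.eq_zero_of_injective _) rfl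
    obtain ⟨φ, rfl⟩ := (Ext.mk₀_bijective _ _).2 c
    obtain ⟨j, hj⟩ := hg (φ.hom (Submodule.Quotient.mk 1))
    obtain ⟨k, hk⟩ := j.2
    refine ⟨max t k, le_max_left _ _, ?_⟩
    change res I (le_max_left t k) e = 0
    let ψ : (R ⧸ I ^ max t k) →ₗ[R] J := Submodule.liftQ _ (LinearMap.toSpanSingleton R J j)
      fun r hr => Subtype.ext (hk r (Ideal.pow_le_pow_right (le_max_right t k) hr))
    have hψ : Ideal.quotientTransition (Ideal.pow_le_pow_right (le_max_left t k)) ≫ φ =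
        ModuleCat.ofHom ψ ≫ (shortComplex hex).g := by
      ext
      refine Eq.trans ?_ (hj.symm.trans (congrArg _ (one_smul R j).symm))
      rfl
    rw [← hc, res_comp, res, Ext.mk₀_comp_mk₀, hψ, ← Ext.mk₀_comp_mk₀,
      Ext.comp_assoc _ _ _ (add_zero 0) (zero_add 1) (by omega), hS.comp_extClass, Ext.comp_zero]
  | succ i =>
    refine of_exact_left hf hex hg (ih i (by omega) ?_) ?_
    · rw [eq_top_iff]
      rintro x -
      obtain ⟨⟨x, k, hk⟩, rfl⟩ := hg x
      exact ⟨k, fun r hr => by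
        rw [← map_smul, (Subtype.ext (hk r hr) : r • (⟨x, k, hk⟩ : J) = 0), map_zero]⟩
    · exact fun t e => ⟨t, le_rfl, by rw [Ext.eq_zero_of_injective e, Ext.comp_zero]⟩

end

/-! ### Local cohomology and the number of generators, by localizing at one generator at a time. -/

section

/-- Each element of `M` is killed by some power of each element of `F`. -/
def IsPowTorsion {R : Type*} [CommRing R] (F : Set R) (M : Type*) [AddCommGroup M] [Module R M] :
    Prop :=
  ∀ f ∈ F, ∀ x : M, ∃ k : ℕ, f ^ k • x = 0

/-- The ideal generated by the `m`-th powers of the members of a list. -/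
def powIdeal {R : Type*} [CommRing R] (gs : List R) (m : ℕ) : Ideal R :=
  Ideal.span ((· ^ m) '' {g | g ∈ gs})

theorem powIdeal_mono {R : Type*} [CommRing R] {g : R} {gs : List R} {m : ℕ} :
    powIdeal gs m ≤ powIdeal (g :: gs) m :=
  Ideal.span_mono (Set.image_mono fun _ h => List.mem_cons_of_mem _ h)

theorem prod_pow_mul_mem_powIdeal {R : Type*} [CommRing R] {gs : List R} {m : ℕ} (c : ℕ) {r : R}
    (hr : r ∈ powIdeal gs m) : gs.prod ^ c * r ∈ powIdeal gs (m + c) := by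
  rw [powIdeal] at hr
  induction hr using Submodule.span_induction with
  | mem x hx =>
    obtain ⟨g, hg, rfl⟩ := hx
    obtain ⟨d, hd⟩ := List.dvd_prod hg
    have : gs.prod ^ c * g ^ m = d ^ c * g ^ (m + c) := by rw [hd]; ring
    change gs.prod ^ c * g ^ m ∈ powIdeal gs (m + c)
    rw [this]
    exact Ideal.mul_mem_left _ _ (Ideal.subset_span ⟨g, hg, rfl⟩)
  | zero => simp
  | add x y _ _ hx hy => rw [mul_add]; exact add_mem hx hy
  | smul a x _ hx => rw [smul_eq_mul, mul_left_comm]; exact Ideal.mul_mem_left _ _ hx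

theorem prod_pow_smul_mem_powIdeal_smul {R : Type*} [CommRing R] {gs : List R} {m : ℕ} (c : ℕ)
    {M : Type*} [AddCommGroup M] [Module R M] {x : M}
    (hx : x ∈ powIdeal gs m • (⊤ : Submodule R M)) :
    gs.prod ^ c • x ∈ powIdeal gs (m + c) • (⊤ : Submodule R M) := by
  refine Submodule.smul_induction_on hx (fun r hr n hn => ?_) fun x y hx hy => ?_
  · rw [← mul_smul]
    exact Submodule.smul_mem_smul (prod_pow_mul_mem_powIdeal c hr) hn
  · rw [smul_add]
    exact add_mem hx hy

theorem LinearMap.exact_ker_subtype_rangeRestrict {R M N : Type*} [Ring R] [AddCommGroup M]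
    [Module R M] [AddCommGroup N] [Module R N] (f : M →ₗ[R] N) :
    Function.Exact (LinearMap.ker f).subtype f.rangeRestrict := fun y => by
  simp [Subtype.ext_iff]

namespace IsPowTorsion

variable {R : Type*} [CommRing R] {F : Set R} {M N : Type*} [AddCommGroup M] [Module R M]
  [AddCommGroup N] [Module R N]

theorem of_injective (h : IsPowTorsion F N) (f : M →ₗ[R] N) (hf : Function.Injective f) :
    IsPowTorsion F M := fun a ha x => by
  obtain ⟨k, hk⟩ := h a ha (f x)
  exact ⟨k, hf (by rw [map_smul, hk, map_zero])⟩

theorem of_surjective (h : IsPowTorsion F M) (f : M →ₗ[R] N) (hf : Function.Surjective f) :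
    IsPowTorsion F N := fun a ha y => by
  obtain ⟨x, rfl⟩ := hf y
  obtain ⟨k, hk⟩ := h a ha x
  exact ⟨k, by rw [← map_smul, hk, map_zero]⟩

theorem localizedModule (h : IsPowTorsion F M) (S : Submonoid R) :
    IsPowTorsion F (LocalizedModule S M) := fun a ha y => by
  induction y with | _ x s
  obtain ⟨k, hk⟩ := h a ha x
  exact ⟨k, by rw [LocalizedModule.smul'_mk, hk, LocalizedModule.zero_mk]⟩

theorem insert_iff {a : R} : IsPowTorsion (insert a F) M ↔
    (∀ x : M, ∃ k : ℕ, a ^ k • x = 0) ∧ IsPowTorsion F M := by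
  simp [IsPowTorsion]

theorem powerTorsion_eq_top [IsNoetherianRing R] {I : Ideal R} (h : IsPowTorsion F M)
    (hI : I ≤ (Ideal.span F).radical) : powerTorsion I M = ⊤ := by
  rw [eq_top_iff]
  rintro x -
  let J : Ideal R := LinearMap.ker (LinearMap.toSpanSingleton R M x)
  have hF : Ideal.span F ≤ J.radical := Ideal.span_le.2 fun a ha => by
    obtain ⟨k, hk⟩ := h a ha x
    exact ⟨k, by simpa [J] using hk⟩
  obtain ⟨k, hk⟩ := Ideal.exists_pow_le_of_le_radical_of_fg
    (hI.trans (Ideal.radical_le_radical_iff.2 hF)) (IsNoetherian.noetherian I)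
  exact ⟨k, fun r hr => by simpa [J] using hk hr⟩

end IsPowTorsion

section Localization

variable {R : Type u} [CommRing R] (g : R) (M : Type u) [AddCommGroup M] [Module R M]

/-- The map from a module to its localization away from `g`. -/
noncomputable abbrev toAway : M →ₗ[R] LocalizedModule (Submonoid.powers g) M :=
  LocalizedModule.mkLinearMap (Submonoid.powers g) M

variable {g M}

theorem toAway_eq_zero {x : M} (h : toAway g M x = 0) : ∃ k : ℕ, g ^ k • x = 0 := by
  obtain ⟨⟨_, k, rfl⟩, hk⟩ := (IsLocalizedModule.eq_zero_iff (Submonoid.powers g) _).1 h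
  exact ⟨k, hk⟩

theorem exists_toAway_eq (y : LocalizedModule (Submonoid.powers g) M) :
    ∃ (k : ℕ) (x : M), g ^ k • y = toAway g M x := by
  obtain ⟨⟨x, ⟨_, k, rfl⟩⟩, h⟩ := IsLocalizedModule.surj (Submonoid.powers g) (toAway g M) y
  exact ⟨k, x, h⟩

theorem lsmul_away_bijective :
    Function.Bijective (LinearMap.lsmul R (LocalizedModule (Submonoid.powers g) M) g) :=
  (Module.End.isUnit_iff _).1
    (IsLocalizedModule.map_units (toAway g M) ⟨g, Submonoid.mem_powers g⟩)

theorem exists_toAway_eq_of_mem_smul {J : Ideal R} {y : LocalizedModule (Submonoid.powers g) M}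
    (hy : y ∈ J • (⊤ : Submodule R (LocalizedModule (Submonoid.powers g) M))) :
    ∃ (k : ℕ) (x : M), x ∈ J • (⊤ : Submodule R M) ∧ g ^ k • y = toAway g M x := by
  refine Submodule.smul_induction_on hy (fun r hr n _ => ?_) ?_
  · obtain ⟨k, x, hx⟩ := exists_toAway_eq n
    exact ⟨k, r • x, Submodule.smul_mem_smul hr trivial, by rw [smul_comm, hx, map_smul]⟩
  · rintro y z ⟨k, x, hx, hxy⟩ ⟨l, w, hw, hwz⟩
    refine ⟨k + l, g ^ l • x + g ^ k • w,
      add_mem (Submodule.smul_mem _ _ hx) (Submodule.smul_mem _ _ hw), ?_⟩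
    rw [map_add, map_smul, map_smul, ← hxy, ← hwz, ← mul_smul, ← mul_smul, ← pow_add, ← pow_add,
      smul_add, add_comm l k]

variable {F : Set R}

theorem IsPowTorsion.ker_toAway (h : IsPowTorsion F M) :
    IsPowTorsion (insert g F) (LinearMap.ker (toAway g M)) :=
  IsPowTorsion.insert_iff.2 ⟨fun x => by
    obtain ⟨k, hk⟩ := toAway_eq_zero x.2
    exact ⟨k, Subtype.ext hk⟩, h.of_injective _ (Submodule.subtype_injective _)⟩

theorem IsPowTorsion.coker_toAway (h : IsPowTorsion F M) :
    IsPowTorsion (insert g F)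
      (LocalizedModule (Submonoid.powers g) M ⧸ LinearMap.range (toAway g M)) :=
  IsPowTorsion.insert_iff.2 ⟨fun x => by
    obtain ⟨y, rfl⟩ := Submodule.mkQ_surjective _ x
    obtain ⟨k, z, hk⟩ := exists_toAway_eq y
    refine ⟨k, ?_⟩
    rw [← map_smul, hk]
    exact (Submodule.Quotient.mk_eq_zero _).2 ⟨z, rfl⟩,
    (h.localizedModule _).of_surjective _ (Submodule.mkQ_surjective _)⟩

end Localization

namespace LocalCohomologyVanishes

variable {R : Type u} [CommRing R] {I : Ideal R}

theorem span_insert_le {F : Set R} {g : R} {gs : List R}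
    (h : I ≤ (Ideal.span (F ∪ {x | x ∈ g :: gs})).radical) :
    I ≤ (Ideal.span (insert g F ∪ {x | x ∈ gs})).radical := by
  have : insert g F ∪ {x | x ∈ gs} = F ∪ {x | x ∈ g :: gs} := by
    ext x
    simp only [Set.mem_union, Set.mem_insert_iff, Set.mem_ofPred_eq, List.mem_cons]
    tauto
  rwa [this]

theorem range_toAway {M : Type u} [AddCommGroup M] [Module R M] {g : R} (hg : g ∈ I) {i : ℕ}
    (h : LocalCohomologyVanishes I i
      (LocalizedModule (Submonoid.powers g) M ⧸ LinearMap.range (toAway g M))) :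
    LocalCohomologyVanishes I (i + 1) (LinearMap.range (toAway g M)) :=
  of_exact_left (Submodule.subtype_injective _) (LinearMap.exact_subtype_mkQ _)
    (Submodule.mkQ_surjective _) h (of_smul_bijective hg lsmul_away_bijective _)

variable [IsNoetherianRing R]

/-- The kernel and cokernel of M → M_g are g-power torsion, so `g` can be moved from the list into
`F`. As M_g has no local cohomology, H^(i+1) of the image is controlled by H^i of the cokernel. With
an empty list M is I-power torsion. -/
theorem of_length_lt {F : Set R} {gs : List R} (hgs : ∀ g ∈ gs, g ∈ I)
    (hI : I ≤ (Ideal.span (F ∪ {x | x ∈ gs})).radical) {M : Type u} [AddCommGroup M] [Module R M]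
    (hM : IsPowTorsion F M) {i : ℕ} (hi : gs.length < i) : LocalCohomologyVanishes I i M := by
  induction gs generalizing F M i with
  | nil =>
    obtain ⟨i, rfl⟩ := Nat.exists_eq_succ_of_ne_zero hi.ne'
    exact of_powerTorsion_eq_top (hM.powerTorsion_eq_top (by simpa using hI)) i
  | cons g gs ih =>
    obtain ⟨i, rfl⟩ := Nat.exists_eq_succ_of_ne_zero (Nat.ne_zero_of_lt hi)
    rw [List.length_cons] at hi
    have hgs' : ∀ g ∈ gs, g ∈ I := fun x hx => hgs x (List.mem_cons_of_mem _ hx)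
    refine of_exact (Submodule.subtype_injective (LinearMap.ker (toAway g M)))
      (toAway g M).exact_ker_subtype_rangeRestrict
      (toAway g M).surjective_rangeRestrict ?_ ?_
    · exact ih hgs' (span_insert_le hI) hM.ker_toAway (by omega)
    · exact range_toAway (hgs g List.mem_cons_self)
        (ih hgs' (span_insert_le hI) hM.coker_toAway (by omega))

/-- This is the vanishing of the class of x/(g₁⋯g_r)^t in top Čech cohomology, obtained without the
Čech complex. Its contrapositive detects nonzero local cohomology. -/
theorem exists_prod_pow_smul_mem {F : Set R} {gs : List R} (hgs : ∀ g ∈ gs, g ∈ I)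
    (hI : I ≤ (Ideal.span (F ∪ {x | x ∈ gs})).radical) {M : Type u} [AddCommGroup M] [Module R M]
    (hM : IsPowTorsion F M) (h : LocalCohomologyVanishes I gs.length M) (x : M) (t : ℕ) :
    ∃ s : ℕ, gs.prod ^ s • x ∈ powIdeal gs (s + t) • (⊤ : Submodule R M) := by
  induction gs generalizing F M with
  | nil =>
    obtain ⟨k, hk⟩ : x ∈ powerTorsion I M := by
      rw [hM.powerTorsion_eq_top (by simpa using hI)]; trivial
    rw [h.eq_zero_of_pow_smul_eq_zero hk]
    exact ⟨0, by simp⟩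
  | cons g gs ih =>
    have hgs' : ∀ g ∈ gs, g ∈ I := fun x hx => hgs x (List.mem_cons_of_mem _ hx)
    have hI' := span_insert_le hI
    have hr : LocalCohomologyVanishes I (gs.length + 1) (LinearMap.range (toAway g M)) :=
      of_exact_right (Submodule.subtype_injective (LinearMap.ker (toAway g M)))
        (toAway g M).exact_ker_subtype_rangeRestrict
        (toAway g M).surjective_rangeRestrict h
        (of_length_lt hgs' hI' hM.ker_toAway (by omega))
    have hC : LocalCohomologyVanishes I gs.length
        (LocalizedModule (Submonoid.powers g) M ⧸ LinearMap.range (toAway g M)) :=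
      of_exact_right (Submodule.subtype_injective _) (LinearMap.exact_subtype_mkQ _)
        (Submodule.mkQ_surjective _) (of_smul_bijective (hgs g List.mem_cons_self)
          lsmul_away_bijective _) hr
    -- The fraction x/g^t supplies the denominator of `g`; the induction hypothesis is applied to
    -- its class in M_g/M.
    let y : LocalizedModule (Submonoid.powers g) M := LocalizedModule.mk x ⟨g ^ t, t, rfl⟩
    have hy : g ^ t • y = toAway g M x := by
      rw [LocalizedModule.smul'_mk]
      exact LocalizedModule.mk_cancel (⟨g ^ t, t, rfl⟩ : Submonoid.powers g) x
    obtain ⟨s, hs⟩ := ih hgs' hI' hM.coker_toAway hC (Submodule.mkQ _ y)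
    rw [← map_smul, ← Submodule.range_mkQ, LinearMap.range_eq_map (Submodule.mkQ _),
      ← Submodule.map_smul'',
      ← Submodule.mem_comap, Submodule.comap_map_mkQ, Submodule.mem_sup] at hs
    obtain ⟨_, ⟨w, rfl⟩, z, hz, hwz⟩ := hs
    obtain ⟨a, z', hz', haz⟩ := exists_toAway_eq_of_mem_smul hz
    have h1 : toAway g M (g ^ a • gs.prod ^ s • x - (g ^ (a + t) • w + g ^ t • z')) = 0 := by
      rw [map_sub, map_add, map_smul, map_smul, map_smul, map_smul, ← haz, ← hy, pow_add,
        smul_comm (gs.prod ^ s), ← hwz]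
      module
    obtain ⟨b, hb⟩ := toAway_eq_zero h1
    rw [smul_sub, sub_eq_zero] at hb
    -- Here a clears the denominator of `z`, and b makes an equality in M_g hold in M.
    refine ⟨s + (a + b), ?_⟩
    have h2 : (g :: gs).prod ^ (s + (a + b)) • x =
        g ^ (s + (a + b) + t) • (gs.prod ^ (a + b) • w) +
          g ^ (s + b + t) • (gs.prod ^ (a + b) • z') := by
      have : (g :: gs).prod ^ (s + (a + b)) • x =
          (g ^ s * gs.prod ^ (a + b)) • (g ^ b • g ^ a • gs.prod ^ s • x) := by
        rw [List.prod_cons]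
        simp only [← mul_smul]
        congr 1
        ring
      rw [this, hb]
      simp only [smul_add, ← mul_smul]
      congr 2 <;> ring
    rw [h2]
    refine add_mem (Submodule.smul_mem_smul (Ideal.subset_span ⟨g, List.mem_cons_self, rfl⟩)
      trivial) (Submodule.smul_mem _ _ (Submodule.smul_mono_left powIdeal_mono ?_))
    have := prod_pow_smul_mem_powIdeal_smul (a + b) hz'
    rwa [show s + t + (a + b) = s + (a + b) + t by ring] at this

end LocalCohomologyVanishes

end

/-! ### Cohomological dimension depends only on the support. -/

section

open scoped TensorProduct

theorem Ideal.isLocalizedModule_quotient_residueField {R : Type*} [CommRing R] (p : Ideal R)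
    [p.IsPrime] : IsLocalizedModule p.primeCompl
      (IsScalarTower.toAlgHom R (R ⧸ p) p.ResidueField).toLinearMap := by
  have hne (x : p.primeCompl) : algebraMap R p.ResidueField x ≠ 0 := fun h =>
    x.2 (Ideal.algebraMap_residueField_eq_zero.1 h)
  refine ⟨fun x => ?_, fun y => ?_, fun {x y} h => ⟨1, ?_⟩⟩
  · rw [Module.End.isUnit_iff]
    constructor
    · intro y z h
      simp only [Module.algebraMap_end_apply, Algebra.smul_def] at h
      exact mul_left_cancel₀ (hne x) h
    · intro y
      refine ⟨(algebraMap R p.ResidueField x)⁻¹ * y, ?_⟩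
      simp only [Module.algebraMap_end_apply, Algebra.smul_def]
      exact mul_inv_cancel_left₀ (hne x) y
  · obtain ⟨a, b, hb, rfl⟩ := IsFractionRing.div_surjective (A := R ⧸ p) y
    obtain ⟨b, rfl⟩ := Ideal.Quotient.mk_surjective b
    have hb' : b ∉ p := fun h =>
      nonZeroDivisors.ne_zero hb (Ideal.Quotient.eq_zero_iff_mem.2 h)
    refine ⟨(a, ⟨b, hb'⟩), ?_⟩
    have h1 : algebraMap (R ⧸ p) p.ResidueField (Ideal.Quotient.mk p b) ≠ 0 := hne ⟨b, hb'⟩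
    change b • _ = algebraMap (R ⧸ p) p.ResidueField a
    rw [Algebra.smul_def]
    exact mul_div_cancel₀ _ h1
  · rw [one_smul, one_smul]
    exact IsFractionRing.injective (R ⧸ p) p.ResidueField h

/-- The fibre of M over the residue field is nonzero, so a linear functional gives a nonzero map M →
κ(p). Since κ(p) is a localization of R/p and M is finitely presented, denominators can be cleared.
-/
theorem Module.exists_ne_zero_hom_quotient {R M : Type*} [CommRing R] [IsNoetherianRing R]
    [AddCommGroup M] [Module R M] [Module.Finite R M] {p : PrimeSpectrum R}
    (hp : p ∈ Module.support R M) : ∃ φ : M →ₗ[R] R ⧸ p.asIdeal, φ ≠ 0 := by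
  let k := p.asIdeal.ResidueField
  have hn := (Module.mem_support_iff_nontrivial_residueField_tensorProduct p).1 hp
  obtain ⟨v, hv⟩ := exists_ne (0 : k ⊗[R] M)
  obtain ⟨l, hl⟩ : ∃ l : Module.Dual k (k ⊗[R] M), l v ≠ 0 := by
    by_contra! h
    exact hv ((Module.forall_dual_apply_eq_zero_iff k v).1 h)
  let g : M →ₗ[R] k := l.restrictScalars R ∘ₗ TensorProduct.mk R k M 1
  have hg : g ≠ 0 := by
    intro h0
    apply hl
    have : ∀ w : k ⊗[R] M, l w = 0 := fun w => by
      induction w with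
      | zero => simp
      | add x y hx hy => rw [map_add, hx, hy, add_zero]
      | tmul a m =>
        have h1 : a ⊗ₜ[R] m = a • ((1 : k) ⊗ₜ[R] m) := by simp [TensorProduct.smul_tmul']
        have h2 : l ((1 : k) ⊗ₜ[R] m) = 0 := congrArg (fun f => f m) h0
        rw [h1, map_smul, h2, smul_zero]
    exact this v
  have := p.asIdeal.isLocalizedModule_quotient_residueField
  have := Module.finitePresentation_of_finite R M
  obtain ⟨h, s, hs⟩ := Module.FinitePresentation.exists_lift_of_isLocalizedModule
    p.asIdeal.primeCompl (IsScalarTower.toAlgHom R (R ⧸ p.asIdeal) k).toLinearMap g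
  refine ⟨h, fun h0 => hg ?_⟩
  rw [h0, LinearMap.comp_zero] at hs
  ext m
  have h1 : s • g m = 0 := congrArg (fun f => f m) hs.symm
  rw [Submonoid.smul_def, Algebra.smul_def, mul_eq_zero] at h1
  exact h1.resolve_left fun h2 => s.2 (Ideal.algebraMap_residueField_eq_zero.1 h2)

/-- All local cohomology `H^i_I(M)` with `i ≥ d` vanishes. -/
def CohomDimLT {R : Type u} [CommRing R] (I : Ideal R) (d : ℕ) (M : Type u) [AddCommGroup M]
    [Module R M] : Prop :=
  ∀ i, d ≤ i → LocalCohomologyVanishes I i M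

variable {R : Type u} [CommRing R] [IsNoetherianRing R] {I : Ideal R}

theorem LocalCohomologyVanishes.of_forall_support {i : ℕ} {N : Type u} [AddCommGroup N]
    [Module R N] [Module.Finite R N]
    (h : ∀ p ∈ Module.support R N, LocalCohomologyVanishes I i (R ⧸ p.asIdeal)) :
    LocalCohomologyVanishes I i N := by
  induction ‹Module.Finite R N› using
    IsNoetherianRing.induction_on_isQuotientEquivQuotientPrime R with
  | subsingleton N => exact .of_subsingleton i
  | quotient N p f =>
    refine (h p ?_).congr f.symm
    rw [f.support_eq, Module.mem_support_iff_of_finite, Ideal.annihilator_quotient]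
  | exact N₁ N₂ N₃ f g hf hg hfg h₁ h₃ =>
    rw [Module.support_of_exact hfg hf hg] at h
    exact .of_exact hf hfg hg (h₁ fun p hp => h p (.inl hp)) (h₃ fun p hp => h p (.inr hp))

namespace CohomDimLT

/-- Descending induction on the degree, and within it Noetherian induction on p from the larger
primes. For a nonzero map φ : M → R/p, the kernel is handled one degree higher, so H^i of the image
vanishes; the cokernel is supported at primes strictly above p. Bounded cohomology starts the
descent. -/
theorem quotient_of_mem_support {D : ℕ}
    (hD : ∀ (N : Type u) [AddCommGroup N] [Module R N], CohomDimLT I D N) {d : ℕ} {M : Type u}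
    [AddCommGroup M] [Module R M] [Module.Finite R M] (h : CohomDimLT I d M)
    {p : PrimeSpectrum R} (hp : p ∈ Module.support R M) : CohomDimLT I d (R ⧸ p.asIdeal) := by
  suffices H : ∀ j i, d ≤ i → D ≤ i + j → ∀ p ∈ Module.support R M,
      LocalCohomologyVanishes I i (R ⧸ p.asIdeal) from
    fun i hi => H D i hi (by omega) p hp
  intro j
  induction j with
  | zero => exact fun i _ hi p _ => hD _ i hi
  | succ j ih =>
    intro i hi hj p
    have : WellFoundedGT (PrimeSpectrum R) :=
      StrictMono.wellFoundedGT (f := fun q : PrimeSpectrum R => q.asIdeal) fun _ _ h => h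
    induction p using WellFoundedGT.induction with | _ p ihp
    intro hp
    obtain ⟨φ, hφ⟩ := Module.exists_ne_zero_hom_quotient hp
    have hker : LocalCohomologyVanishes I (i + 1) (LinearMap.ker φ) :=
      .of_forall_support fun q hq => ih (i + 1) (by omega) (by omega) q
        (Module.support_subset_of_injective _ (Submodule.subtype_injective _) hq)
    have hrange : LocalCohomologyVanishes I i (LinearMap.range φ) :=
      .of_exact_right (Submodule.subtype_injective _) φ.exact_ker_subtype_rangeRestrict
        φ.surjective_rangeRestrict (h i hi) hker
    refine .of_exact (Submodule.subtype_injective (LinearMap.range φ))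
      (LinearMap.exact_subtype_mkQ _) (Submodule.mkQ_surjective _) hrange
      (.of_forall_support fun q hq => ?_)
    have hq' := Module.annihilator_le_of_mem_support hq
    have hle : p.asIdeal ≤ q.asIdeal := fun a ha => hq' <| by
      rw [Module.mem_annihilator]
      intro x
      obtain ⟨x, rfl⟩ := Submodule.mkQ_surjective _ x
      obtain ⟨x, rfl⟩ := Ideal.Quotient.mk_surjective x
      rw [← map_smul]
      have : a • Ideal.Quotient.mk p.asIdeal x = 0 :=
        Ideal.Quotient.eq_zero_iff_mem.2 (Ideal.mul_mem_right _ _ ha)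
      rw [this, map_zero]
    -- Every value of φ annihilates the cokernel; if q were p, all these values would be zero in
    -- R/p.
    have hlt : p.asIdeal ≠ q.asIdeal := fun heq => by
      apply hφ
      ext m
      obtain ⟨a, ha⟩ := Ideal.Quotient.mk_surjective (φ m)
      rw [← ha]
      refine Ideal.Quotient.eq_zero_iff_mem.2 (heq ▸ hq' ?_)
      rw [Module.mem_annihilator]
      intro x
      obtain ⟨x, rfl⟩ := Submodule.mkQ_surjective _ x
      obtain ⟨x, rfl⟩ := Ideal.Quotient.mk_surjective x
      rw [← map_smul]
      have : a • Ideal.Quotient.mk p.asIdeal x = φ (x • m) := by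
        rw [map_smul, ← ha, Algebra.smul_def, Algebra.smul_def, mul_comm]
        rfl
      rw [this]
      exact (Submodule.Quotient.mk_eq_zero _).2 ⟨_, rfl⟩
    exact ihp q (lt_of_le_of_ne hle fun h => hlt (congrArg _ h)) (Module.mem_support_mono hle hp)

theorem of_support_subset {D : ℕ}
    (hD : ∀ (N : Type u) [AddCommGroup N] [Module R N], CohomDimLT I D N) {d : ℕ} {M N : Type u}
    [AddCommGroup M] [Module R M] [Module.Finite R M] [AddCommGroup N] [Module R N]
    [Module.Finite R N] (h : CohomDimLT I d M)
    (hs : Module.support R N ⊆ Module.support R M) : CohomDimLT I d N := fun i hi =>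
  .of_forall_support fun _ hp => quotient_of_mem_support hD h (hs hp) i hi

end CohomDimLT

end

/-! ### Regular sequences and chains of primes. -/

section

variable {R : Type*} [CommRing R] [IsNoetherianRing R]

/-- Let N' be the elements killed by p. Regularity of x makes N'/xN' embed in N/xN, and P lies in
its support; q is a minimal prime of its annihilator below P. It contains p and x, whereas x is not
in p. -/
theorem exists_lt_associatedPrime_quotSMulTop {N : Type*} [AddCommGroup N] [Module R N]
    [Module.Finite R N] {p P : Ideal R} [P.IsPrime] (hp : p ∈ associatedPrimes R N) (hpP : p ≤ P)
    {x : R} (hxP : x ∈ P) (hx : IsSMulRegular N x) :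
    ∃ q ∈ associatedPrimes R (QuotSMulTop x N), p < q ∧ q ≤ P := by
  obtain ⟨_, n, hn⟩ := isAssociatedPrime_iff.1 hp
  let N' : Submodule R N := Submodule.torsionBySet R N (p : Set R)
  have hN' (y : N) : y ∈ N' ↔ ∀ a ∈ p, a • y = 0 := by
    simp [N', Submodule.mem_torsionBySet_iff]
  have hnN' : n ∈ N' := (hN' n).2 fun a ha => by
    rw [hn, Submodule.mem_colon_singleton] at ha
    simpa using ha
  have hsupp : (⟨P, ‹_›⟩ : PrimeSpectrum R) ∈ Module.support R (QuotSMulTop x N') := by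
    rw [Module.support_quotSMulTop]
    refine ⟨?_, by simpa using hxP⟩
    rw [Module.mem_support_iff_of_finite]
    intro a ha
    apply hpP
    rw [hn, Submodule.mem_colon_singleton]
    have := (Module.mem_annihilator.1 ha) ⟨n, hnN'⟩
    simpa using congrArg Subtype.val this
  obtain ⟨q, hq, hqP⟩ := Ideal.exists_minimalPrimes_le (Module.annihilator_le_of_mem_support hsupp)
  have hqA := Module.associatedPrimes.minimalPrimes_annihilator_subset_associatedPrimes R _ hq
  have hinj : Function.Injective (QuotSMulTop.map x N'.subtype) := by
    rw [injective_iff_map_eq_zero]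
    intro y hy
    obtain ⟨y, rfl⟩ := Submodule.mkQ_surjective _ y
    rw [Submodule.mkQ_apply, QuotSMulTop.map_apply_mk] at hy
    rw [Submodule.Quotient.mk_eq_zero] at hy
    obtain ⟨z, -, hz⟩ := hy
    have hzx : x • z = y := hz
    have hzN : z ∈ N' := (hN' z).2 fun a ha => hx <| by
      change x • a • z = x • 0
      rw [smul_comm, hzx, (hN' _).1 y.2 a ha, smul_zero]
    refine (Submodule.Quotient.mk_eq_zero _).2 ⟨⟨z, hzN⟩, trivial, Subtype.ext hzx⟩
  have hqprime : q.IsPrime := hq.1.1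
  have hxq : x ∈ q := hq.1.2 ((QuotSMulTop.mem_annihilator _ x))
  have hpq : p ≤ q := fun a ha => hq.1.2 <| by
    rw [Module.mem_annihilator]
    intro y
    obtain ⟨y, rfl⟩ := Submodule.mkQ_surjective _ y
    rw [← map_smul, show a • y = 0 from Subtype.ext ((hN' _).1 y.2 a ha), map_zero]
  refine ⟨q, associatedPrimes.subset_of_injective hinj hqA,
    lt_of_le_of_ne hpq fun h => ?_, hqP⟩
  rw [← h, hn, Submodule.mem_colon_singleton, Submodule.mem_bot] at hxq
  have hn0 : n = 0 := hx (by simpa using hxq)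
  exact hp.1.ne_top (by rw [hn, hn0]; simp)

theorem exists_ltSeries_of_isWeaklyRegular {N : Type*} [AddCommGroup N] [Module R N]
    [Module.Finite R N] {p P : PrimeSpectrum R} (hp : p.asIdeal ∈ associatedPrimes R N)
    (hpP : p ≤ P) {rs : List R} (hrs : ∀ r ∈ rs, r ∈ P.asIdeal)
    (h : RingTheory.Sequence.IsWeaklyRegular N rs) :
    ∃ l : LTSeries (PrimeSpectrum R), l.head = p ∧ l.last ≤ P ∧ l.length = rs.length := by
  induction rs generalizing N p with
  | nil => exact ⟨RelSeries.singleton _ p, rfl, hpP, rfl⟩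
  | cons x rs ih =>
    rw [RingTheory.Sequence.isWeaklyRegular_cons_iff] at h
    obtain ⟨q, hq, hpq, hqP⟩ := exists_lt_associatedPrime_quotSMulTop hp hpP
      (hrs x List.mem_cons_self) h.1
    obtain ⟨l, hl, hl', hlen⟩ := ih (p := ⟨q, hq.1⟩) hq hqP
      (fun r hr => hrs r (List.mem_cons_of_mem _ hr)) h.2
    exact ⟨l.cons p (by rw [hl]; exact hpq), by simp, by simpa using hl', by simp [hlen]⟩

/-- Each term of the sequence gives a strict step in a chain of primes from p to P. In R/p the prime
P is minimal over the image of `s`, so Krull's height theorem bounds the chain. -/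
theorem length_le_of_isWeaklyRegular {N : Type*} [AddCommGroup N] [Module R N]
    [Module.Finite R N] {p P : Ideal R} (hp : p ∈ associatedPrimes R N) {s : Finset R}
    (hP : P ∈ (p ⊔ Ideal.span s).minimalPrimes) {rs : List R} (hrs : ∀ r ∈ rs, r ∈ P)
    (h : RingTheory.Sequence.IsWeaklyRegular N rs) : rs.length ≤ s.card := by
  classical
  have hPp : P.IsPrime := hP.1.1
  obtain ⟨l, hl, hl', hlen⟩ := exists_ltSeries_of_isWeaklyRegular (p := ⟨p, hp.1⟩) (P := ⟨P, hPp⟩)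
    hp (le_sup_left.trans hP.1.2) hrs h
  have hcomap : p ⊔ Ideal.span s =
      (Ideal.span (s.image (Ideal.Quotient.mk p) : Set (R ⧸ p))).comap (Ideal.Quotient.mk p) := by
    rw [Finset.coe_image, ← Ideal.map_span,
      Ideal.comap_map_of_surjective' _ Ideal.Quotient.mk_surjective, Ideal.mk_ker, sup_comm]
  rw [hcomap, Ideal.comap_minimalPrimes_eq_of_surjective Ideal.Quotient.mk_surjective] at hP
  obtain ⟨P', hP', rfl⟩ := hP
  have hP'p : P'.IsPrime := hP'.1.1
  have hheight := Ideal.height_le_card_of_mem_minimalPrimes_span_finset hP'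
  let e := Ideal.primeSpectrumQuotientOrderIsoZeroLocus p
  have hmem (i) : l i ∈ PrimeSpectrum.zeroLocus (p : Set R) := by
    have : l.head ≤ l i := l.head_le i
    rw [hl] at this
    exact this
  let l' : LTSeries (PrimeSpectrum (R ⧸ p)) :=
    { length := l.length
      toFun := fun i => e.symm ⟨l i, hmem i⟩
      step := fun i => e.symm.strictMono (l.step i) }
  have hlast : l'.last ≤ ⟨P', hP'p⟩ := by
    change e.symm _ ≤ _
    rw [e.symm_apply_le]
    exact hl'
  have h1 := Order.length_le_height hlast
  rw [← PrimeSpectrum.height_eq_orderHeight] at h1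
  have h2 : (l.length : ℕ∞) ≤ (s.image (Ideal.Quotient.mk p)).card := h1.trans hheight
  rw [hlen, Nat.cast_le] at h2
  exact h2.trans Finset.card_image_le

end

/-! ### Homogeneous parameters in a polynomial ring over a field. -/

namespace MvPolynomial

variable {σ K : Type*} [Field K]

attribute [local instance] MvPolynomial.gradedAlgebra

theorem mem_idealOfVars_iff_coeff {p : MvPolynomial σ K} :
    p ∈ idealOfVars σ K ↔ p.coeff 0 = 0 := by
  have := mem_pow_idealOfVars_iff' (σ := σ) (R := K) 1 p
  rw [pow_one] at this
  simp [this, Finsupp.degree_eq_zero_iff]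

theorem isMaximal_idealOfVars : (idealOfVars σ K).IsMaximal := by
  have : idealOfVars σ K = RingHom.ker (constantCoeff : MvPolynomial σ K →+* K) := by
    ext p
    rw [mem_idealOfVars_iff_coeff, RingHom.mem_ker, constantCoeff_eq]
  rw [this]
  exact RingHom.ker_isMaximal_of_surjective _ fun x => ⟨C x, by simp⟩

theorem le_idealOfVars_of_isHomogeneous {I : Ideal (MvPolynomial σ K)}
    (h : I.IsHomogeneous (homogeneousSubmodule σ K)) (hI : I ≠ ⊤) : I ≤ idealOfVars σ K := by
  intro p hp
  rw [mem_idealOfVars_iff_coeff]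
  by_contra h0
  have h1 := homogeneousComponent_mem_of_mem h hp 0
  rw [homogeneousComponent_zero] at h1
  exact hI (Ideal.eq_top_of_isUnit_mem _ h1 ((isUnit_iff_ne_zero.2 h0).map C))

theorem exists_homogeneous_notMem {I p : Ideal (MvPolynomial σ K)}
    (hI : I.IsHomogeneous (homogeneousSubmodule σ K)) (h : ¬ I ≤ p) :
    ∃ e, ∃ f ∈ I, f.IsHomogeneous e ∧ f ∉ p := by
  obtain ⟨x, hx, hxp⟩ := SetLike.not_le_iff_exists.1 h
  by_contra! H
  refine hxp ?_
  rw [← sum_homogeneousComponent x]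
  exact Ideal.sum_mem _ fun i _ => H i _ (homogeneousComponent_mem_of_mem hI hx i)
    (homogeneousComponent_isHomogeneous i x)

/-- Homogeneous prime avoidance. -/
theorem exists_homogeneous_forall_notMem (s : Finset (Ideal (MvPolynomial σ K)))
    (hprime : ∀ p ∈ s, p.IsPrime) (hhom : ∀ p ∈ s, p.IsHomogeneous (homogeneousSubmodule σ K))
    (hm : ∀ p ∈ s, ¬ idealOfVars σ K ≤ p) (hs : ∀ p ∈ s, ∀ q ∈ s, p ≤ q → p = q)
    (hne : s.Nonempty) :
    ∃ e, ∃ f : MvPolynomial σ K, 0 < e ∧ f.IsHomogeneous e ∧ ∀ p ∈ s, f ∉ p := by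
  classical
  have hX : ∀ p ∈ s, ∃ j, (X j : MvPolynomial σ K) ∉ p := by
    intro p hp
    by_contra! H
    exact hm p hp (Ideal.span_le.2 (by rintro _ ⟨j, rfl⟩; exact H j))
  induction hne using Finset.Nonempty.cons_induction with
  | singleton p =>
    obtain ⟨j, hj⟩ := hX p (Finset.mem_singleton_self p)
    exact ⟨1, X j, one_pos, isHomogeneous_X K j, by simpa using hj⟩
  | cons p s hps hne ih =>
    have hsub : ∀ q ∈ s, q ∈ Finset.cons p s hps := fun q hq => Finset.mem_cons_of_mem hq
    have hpp : p ∈ Finset.cons p s hps := Finset.mem_cons_self p s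
    obtain ⟨a, f, ha, hf, hfs⟩ := ih (fun q hq => hprime q (hsub q hq))
      (fun q hq => hhom q (hsub q hq)) (fun q hq => hm q (hsub q hq))
      (fun q hq q' hq' => hs q (hsub q hq) q' (hsub q' hq')) (fun q hq => hX q (hsub q hq))
    have := hprime p hpp
    by_cases hfp : f ∈ p
    · have hJ : (⨅ q : s, (q : Ideal (MvPolynomial σ K))).IsHomogeneous
          (homogeneousSubmodule σ K) := Ideal.IsHomogeneous.iInf fun q => hhom q (hsub _ q.2)
      have hJp : ¬ (⨅ q : s, (q : Ideal (MvPolynomial σ K))) ≤ p := by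
        rw [iInf_subtype, ← Finset.inf_eq_iInf, Ideal.IsPrime.inf_le' this]
        rintro ⟨q, hq, hqp⟩
        exact hps (hs q (hsub q hq) p hpp hqp ▸ hq)
      obtain ⟨b, g, hgJ, hg, hgp⟩ := exists_homogeneous_notMem hJ hJp
      obtain ⟨j, hj⟩ := hX p hpp
      have hh := hg.mul (isHomogeneous_X K j)
      have hhp : g * X j ∉ p := fun h => (this.mem_or_mem h).elim hgp hj
      -- The exponents equalize the degrees a and b + 1. Of the two summands, only the second avoids
      -- `p` and only the first avoids the other primes. The factor `X j` keeps the exponents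
      -- positive even if b = 0.
      refine ⟨a * (b + 1), f ^ (b + 1) + (g * X j) ^ a, by positivity, ?_, fun q hq h => ?_⟩
      · exact (hf.pow _).add (by simpa [mul_comm] using hh.pow a)
      · rcases Finset.mem_cons.1 hq with rfl | hq'
        · exact hhp (this.mem_of_pow_mem a ((Ideal.add_mem_iff_right _
            (Ideal.pow_mem_of_mem _ hfp _ (Nat.succ_pos b))).1 h))
        · have hgq : g * X j ∈ q := Ideal.mul_mem_right _ _ ((Ideal.mem_iInf.1 hgJ) ⟨q, hq'⟩)
          exact hfs q hq' ((hprime q hq).mem_of_pow_mem _ ((Ideal.add_mem_iff_left _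
            (Ideal.pow_mem_of_mem _ hgq _ ha)).1 h))
    · refine ⟨a, f, ha, hf, fun q hq => ?_⟩
      rcases Finset.mem_cons.1 hq with rfl | hq'
      · exact hfp
      · exact hfs q hq'

theorem isHomogeneous_of_mem_minimalPrimes {I p : Ideal (MvPolynomial σ K)}
    (hI : I.IsHomogeneous (homogeneousSubmodule σ K)) (hp : p ∈ I.minimalPrimes) :
    p.IsHomogeneous (homogeneousSubmodule σ K) := by
  have h1 : (p.homogeneousCore (homogeneousSubmodule σ K)).toIdeal ≤ p :=
    Ideal.toIdeal_homogeneousCore_le _ p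
  have h2 : I ≤ (p.homogeneousCore (homogeneousSubmodule σ K)).toIdeal := by
    conv_lhs => rw [← hI.toIdeal_homogeneousCore_eq_self]
    exact Ideal.homogeneousCore_mono _ hp.1.2
  have h3 := hp.2 ⟨hp.1.1.homogeneousCore, h2⟩ h1
  rw [le_antisymm h3 h1]
  exact HomogeneousIdeal.isHomogeneous _

/-- A proper homogeneous ideal has a homogeneous system of parameters. -/
theorem exists_homogeneous_parameters [Finite σ] (D : ℕ) (I : Ideal (MvPolynomial σ K))
    (hI : I.IsHomogeneous (homogeneousSubmodule σ K)) (hne : I ≠ ⊤)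
    (hD : ringKrullDim (MvPolynomial σ K ⧸ I) < D) :
    ∃ fs : List (MvPolynomial σ K), (∀ f ∈ fs, ∃ e, 0 < e ∧ f.IsHomogeneous e) ∧
      idealOfVars σ K ≤ (I ⊔ Ideal.span {f | f ∈ fs}).radical ∧
      (fs.length : WithBot ℕ∞) ≤ ringKrullDim (MvPolynomial σ K ⧸ I) := by
  have := Ideal.Quotient.nontrivial_iff.2 hne
  have hdim := ringKrullDim_nonneg_of_nontrivial (R := MvPolynomial σ K ⧸ I)
  induction D generalizing I with
  | zero => exact absurd hD hdim.not_gt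
  | succ D ih =>
    have hhom := fun p hp => isHomogeneous_of_mem_minimalPrimes hI (p := p) hp
    have hle (p) (hp : p ∈ I.minimalPrimes) : p ≤ idealOfVars σ K :=
      le_idealOfVars_of_isHomogeneous (hhom p hp) hp.1.1.ne_top
    by_cases hmin : idealOfVars σ K ∈ I.minimalPrimes
    · refine ⟨[], by simp, ?_, by simpa using hdim⟩
      refine le_trans ?_ (Ideal.radical_mono le_sup_left)
      rw [← Ideal.sInf_minimalPrimes]
      exact le_sInf fun p hp => hmin.2 hp.1 (hle p hp)
    have hfin := I.finite_minimalPrimes_of_isNoetherianRing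
    obtain ⟨e, f, he, hf, hfp⟩ := exists_homogeneous_forall_notMem hfin.toFinset
      (fun p hp => (hfin.mem_toFinset.1 hp).1.1) (fun p hp => hhom p (hfin.mem_toFinset.1 hp))
      (fun p hp h => hmin (le_antisymm h (hle p (hfin.mem_toFinset.1 hp)) ▸
        hfin.mem_toFinset.1 hp))
      (fun p hp q hq h => le_antisymm h
        ((hfin.mem_toFinset.1 hq).2 (hfin.mem_toFinset.1 hp).1 h))
      (by simpa using Set.nonempty_coe_sort.1 (Ideal.nonempty_minimalPrimes hne))
    -- Passing to the radical makes `f`, which avoids the minimal primes, a nonzerodivisor, so the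
    -- dimension drops.
    let J := I.radical ⊔ Ideal.span {f}
    have hJ : J.IsHomogeneous (homogeneousSubmodule σ K) :=
      hI.radical.sup (Ideal.homogeneous_span _ _ fun x hx => ⟨e, by
        rw [Set.mem_singleton_iff.1 hx]; exact hf⟩)
    have hfm : f ∈ idealOfVars σ K := by
      rw [mem_idealOfVars_iff_coeff]
      exact hf.coeff_eq_zero (by simpa using he.ne)
    have hm := isMaximal_idealOfVars (σ := σ) (K := K)
    have hJm : J ≤ idealOfVars σ K := sup_le
      (hm.isPrime.radical_le_iff.2 (le_idealOfVars_of_isHomogeneous hI hne))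
      (Ideal.span_le.2 (by simpa using hfm))
    have hJne : J ≠ ⊤ := fun h => hm.ne_top (top_le_iff.1 (h ▸ hJm))
    have hJI : ringKrullDim (MvPolynomial σ K ⧸ J) + 1 ≤ ringKrullDim (MvPolynomial σ K ⧸ I) := by
      refine le_trans ?_ (ringKrullDim_le_of_surjective
        (Ideal.Quotient.factor (Ideal.le_radical (I := I)))
        (Ideal.Quotient.factor_surjective _))
      refine ringKrullDim_succ_le_of_surjective
        (Ideal.Quotient.factor (le_sup_left : I.radical ≤ J))
        (Ideal.Quotient.factor_surjective _) (r := Ideal.Quotient.mk _ f) ?_ ?_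
      · rw [mem_nonZeroDivisors_iff_right]
        intro x hx
        obtain ⟨x, rfl⟩ := Ideal.Quotient.mk_surjective x
        rw [← map_mul, Ideal.Quotient.eq_zero_iff_mem, ← Ideal.sInf_minimalPrimes] at hx
        rw [Ideal.Quotient.eq_zero_iff_mem, ← Ideal.sInf_minimalPrimes, Submodule.mem_sInf]
        intro p hp
        exact (hp.1.1.mem_or_mem (Submodule.mem_sInf.1 hx p hp)).resolve_right
          (hfp p (hfin.mem_toFinset.2 hp))
      · rw [Ideal.Quotient.factor_mk, Ideal.Quotient.eq_zero_iff_mem]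
        exact Ideal.mem_sup_right (Ideal.mem_span_singleton_self f)
    have := Ideal.Quotient.nontrivial_iff.2 hJne
    obtain ⟨fs, h1, h2, h3⟩ := ih J hJ hJne (ENat.WithBot.add_one_le_natCast_iff.1 (hJI.trans
      (ENat.WithBot.lt_add_one_iff.1 (by simpa using hD)))) this
        (ringKrullDim_nonneg_of_nontrivial)
    refine ⟨f :: fs, ?_, h2.trans (Ideal.radical_le_radical_iff.2 ?_), ?_⟩
    · simpa using ⟨⟨e, he, hf⟩, h1⟩
    · refine sup_le (sup_le (Ideal.radical_mono le_sup_left) ?_) ?_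
      · exact (Ideal.span_mono (by simp)).trans (le_sup_right.trans Ideal.le_radical)
      · exact (Ideal.span_mono fun x hx => List.mem_cons_of_mem _ hx).trans
          (le_sup_right.trans Ideal.le_radical)
    · refine le_trans ?_ hJI
      simpa using by gcongr

end MvPolynomial

/-! ### Graded Noether normalization and nonvanishing in top degree. -/

/-- The Krull dimension does not increase along integral extensions. -/
theorem ringKrullDim_le_of_isIntegral (A B : Type*) [CommRing A] [CommRing B] [Algebra A B]
    [Algebra.IsIntegral A B] : ringKrullDim B ≤ ringKrullDim A := by
  refine Order.krullDim_le_of_strictMono (PrimeSpectrum.comap (algebraMap A B)) fun p q h => ?_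
  exact Ideal.IsIntegral.comap_lt_comap h

/-- A nonzero kernel would make the image of A have dimension below d, and B is integral over that
image. -/
theorem RingHom.Finite.injective_of_ringKrullDim_le {A B : Type*} [CommRing A] [IsDomain A]
    [CommRing B] {φ : A →+* B} (hφ : φ.Finite) {d : ℕ} (hd : ringKrullDim A = d)
    (h : d ≤ ringKrullDim B) : Function.Injective φ := by
  rw [injective_iff_map_eq_zero]
  intro r hr
  by_contra h0
  have h1 := ringKrullDim_succ_le_of_surjective φ.rangeRestrict φ.rangeRestrict_surjective
    (mem_nonZeroDivisors_of_ne_zero h0) (Subtype.ext hr)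
  have : Algebra.IsIntegral φ.range B := ⟨fun x => by
    obtain ⟨p, hp, hpx⟩ := hφ.to_isIntegral x
    refine ⟨p.map φ.rangeRestrict, hp.map _, ?_⟩
    rwa [Polynomial.eval₂_map]⟩
  have h2 := ringKrullDim_le_of_isIntegral φ.range B
  rw [hd] at h1
  exact (ENat.WithBot.add_one_le_natCast_iff.1 h1).not_ge (h.trans h2)

namespace MvPolynomial

variable {σ K : Type*} [Field K]

attribute [local instance] MvPolynomial.gradedAlgebra

/-- The quotient of a polynomial ring by a homogeneous ideal is finite over the subalgebra generated
by homogeneous elements that generate an irrelevant ideal up to radical. -/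
theorem finite_aeval_of_isHomogeneous_ker [Finite σ] {B : Type*} [CommRing B] [Algebra K B]
    (π : MvPolynomial σ K →ₐ[K] B) (hπ : Function.Surjective π)
    (hI : (RingHom.ker π).IsHomogeneous (homogeneousSubmodule σ K)) {d : ℕ} (f : Fin d → MvPolynomial σ K)
    (hf : ∀ i, ∃ e, 0 < e ∧ (f i).IsHomogeneous e)
    (hrad : idealOfVars σ K ≤ (RingHom.ker π ⊔ Ideal.span (Set.range f)).radical) :
    (π.comp (aeval f)).toRingHom.Finite := by
  classical
  obtain ⟨k, hk⟩ := Ideal.exists_pow_le_of_le_radical_of_fg hrad (idealOfVars_fg σ K)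
  choose e he hfe using hf
  let φ := π.comp (aeval f)
  let _ : Algebra (MvPolynomial (Fin d) K) B := φ.toRingHom.toAlgebra
  have hφ (a : MvPolynomial (Fin d) K) (b : MvPolynomial σ K) :
      a • (π b) = π (aeval f a * b) :=
    (map_mul π _ _).symm
  let G : Submodule (MvPolynomial (Fin d) K) B :=
    Submodule.span _ ((fun μ => π (monomial μ 1)) '' {μ : σ →₀ ℕ | μ.degree ≤ k})
  -- Graded Nakayama: a form of degree at least k lies in ker π + (f), and its degree N part
  -- rewrites it with coefficients of smaller degree.
  have key (N : ℕ) : ∀ p : MvPolynomial σ K, p.IsHomogeneous N → π p ∈ G := by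
    induction N using Nat.strong_induction_on with
    | _ N ih =>
      intro p hp
      by_cases hN : N < k
      · rw [p.as_sum, map_sum]
        refine Submodule.sum_mem _ fun μ hμ => ?_
        have : π (monomial μ (p.coeff μ)) =
            (C (p.coeff μ) : MvPolynomial (Fin d) K) • π (monomial μ 1) := by
          rw [hφ, aeval_C, algebraMap_eq, C_mul_monomial, mul_one]
        rw [this]
        refine Submodule.smul_mem _ _ (Submodule.subset_span ⟨μ, ?_, rfl⟩)
        have hdeg : μ.degree = N := by
          by_contra h
          exact mem_support_iff.1 hμ (hp.coeff_eq_zero h)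
        exact hdeg.trans_le hN.le
      · have hpm : p ∈ idealOfVars σ K ^ k := by
          rw [mem_pow_idealOfVars_iff']
          exact fun μ hμ => hp.coeff_eq_zero (by omega)
        obtain ⟨b, hb, g, hg, hbg⟩ := Submodule.mem_sup.1 (hk hpm)
        obtain ⟨c, rfl⟩ := (Ideal.mem_span_range_iff_exists_fun).1 hg
        have hpN := homogeneousComponent_eq_self hp
        rw [← hpN, ← hbg, map_add, map_add, map_sum, map_sum,
          (RingHom.mem_ker).1 (homogeneousComponent_mem_of_mem hI hb N), zero_add]
        refine Submodule.sum_mem _ fun i _ => ?_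
        have h1 : homogeneousComponent N (c i * f i) =
            if e i ≤ N then homogeneousComponent (N - e i) (c i) * f i else 0 := by
          have := DirectSum.coe_decompose_mul_of_right_mem (homogeneousSubmodule σ K) N (a := c i)
            (hfe i)
          rw [← decomposition.decompose'_apply, ← decomposition.decompose'_apply]
          exact this
        rw [h1]
        split_ifs with hi
        · have h2 : π (homogeneousComponent (N - e i) (c i) * f i) =
              (X i : MvPolynomial (Fin d) K) •
                π (homogeneousComponent (N - e i) (c i)) := by
            rw [hφ, aeval_X, mul_comm]
          rw [h2]
          exact Submodule.smul_mem _ _ (ih _ (by have := he i; omega) _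
            (homogeneousComponent_isHomogeneous _ _))
        · simp
  have hG : G = ⊤ := by
    refine eq_top_iff.2 fun x _ => ?_
    obtain ⟨p, rfl⟩ := hπ x
    rw [← sum_homogeneousComponent p, map_sum]
    exact Submodule.sum_mem _ fun i _ => key i _ (homogeneousComponent_isHomogeneous _ _)
  have : Module.Finite (MvPolynomial (Fin d) K) B := by
    refine ⟨hG ▸ Submodule.fg_span (Set.Finite.image _ ?_)⟩
    exact Finsupp.finite_of_degree_le k
  exact this

/-- In a finite faithful module over a polynomial ring, the products of the variables witness that
the top local cohomology is nonzero. -/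
theorem exists_prod_pow_smul_notMem {d : ℕ} (B : Type*) [AddCommGroup B]
    [Module (MvPolynomial (Fin d) K) B] [Module.Finite (MvPolynomial (Fin d) K) B]
    [FaithfulSMul (MvPolynomial (Fin d) K) B] :
    ∃ (b : B) (t : ℕ), ∀ s, (∏ i, X i : MvPolynomial (Fin d) K) ^ s • b ∉
      (Ideal.span (Set.range fun i => (X i : MvPolynomial (Fin d) K) ^ (s + t))) •
        (⊤ : Submodule (MvPolynomial (Fin d) K) B) := by
  have hsupp : (⊥ : PrimeSpectrum (MvPolynomial (Fin d) K)) ∈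
      Module.support (MvPolynomial (Fin d) K) B := by
    rw [Module.mem_support_iff_of_finite]
    rw [Module.annihilator_eq_bot.2 inferInstance]
    exact bot_le
  obtain ⟨ψ', hψ'⟩ := Module.exists_ne_zero_hom_quotient hsupp
  let ψ := (Submodule.quotEquivOfEqBot _ rfl).toLinearMap ∘ₗ ψ'
  obtain ⟨b, hb⟩ : ∃ b, ψ b ≠ 0 := by
    by_contra! H
    exact hψ' (LinearMap.ext fun b => by simpa [ψ] using H b)
  obtain ⟨μ, hμ⟩ := ne_zero_iff.1 hb
  -- A nonzero map ψ to the polynomial ring has a monomial μ in ψ(b). Membership would make some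
  -- X_i^(s + deg μ + 1) divide (∏ X)^s X^μ, forcing μ_i > deg μ.
  refine ⟨b, μ.degree + 1, fun s hs => ?_⟩
  have h1 := Submodule.mem_map_of_mem (f := ψ) hs
  rw [Submodule.map_smul'', map_smul] at h1
  have h2 : (∏ i, X i : MvPolynomial (Fin d) K) ^ s * ψ b ∈
      Ideal.span ((fun ν => monomial ν (1 : K)) ''
        Set.range fun i => Finsupp.single i (s + (μ.degree + 1))) := by
    rw [← Set.range_comp]
    refine Ideal.span_mono ?_ (Ideal.mul_le_left h1)
    rintro _ ⟨i, rfl⟩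
    exact ⟨i, by simp [X_pow_eq_monomial]⟩
  rw [mem_ideal_span_monomial_image] at h2
  have h3 : (∏ i, X i : MvPolynomial (Fin d) K) ^ s = monomial (s • ∑ i, Finsupp.single i 1) 1 := by
    rw [← one_pow (M := K) s, ← monomial_pow, monomial_sum_one]
    rfl
  obtain ⟨_, ⟨i, rfl⟩, hi⟩ := h2 (s • (∑ i, Finsupp.single i 1) + μ) (by
    rw [mem_support_iff, h3, coeff_monomial_mul, one_mul]
    exact hμ)
  have h4 := hi i
  have h5 : (∑ j : Fin d, Finsupp.single j 1 : Fin d →₀ ℕ) i = 1 := by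
    simp [Finsupp.finsetSum_apply, Finsupp.single_apply]
  have h6 := Finsupp.le_degree i μ
  simp only [Finsupp.add_apply, Finsupp.smul_apply, h5, Finsupp.single_eq_same, smul_eq_mul,
    mul_one] at h4
  omega

theorem exists_prod_pow_mul_notMem [Finite σ] {B : Type*} [CommRing B] [Algebra K B]
    (π : MvPolynomial σ K →ₐ[K] B) (hπ : Function.Surjective π)
    (hI : (RingHom.ker π).IsHomogeneous (homogeneousSubmodule σ K)) {fs : List (MvPolynomial σ K)}
    (h1 : ∀ f ∈ fs, ∃ e, 0 < e ∧ f.IsHomogeneous e)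
    (h2 : idealOfVars σ K ≤ (RingHom.ker π ⊔ Ideal.span {f | f ∈ fs}).radical)
    (h3 : (fs.length : WithBot ℕ∞) ≤ ringKrullDim B) :
    ∃ (b : MvPolynomial σ K) (t : ℕ), ∀ s,
      fs.prod ^ s * b ∉ powIdeal fs (s + t) ⊔ RingHom.ker π := by
  have hrange : {f | f ∈ fs} = Set.range fs.get := by
    ext f
    simp [List.mem_iff_get]
  have hfin := finite_aeval_of_isHomogeneous_ker π hπ hI fs.get
    (fun i => h1 _ (List.get_mem _ _)) (by rwa [← hrange])
  have hinj := hfin.injective_of_ringKrullDim_le (d := fs.length) (by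
    rw [MvPolynomial.ringKrullDim_of_isNoetherianRing, ringKrullDim_eq_zero_of_field]
    simp) h3
  let _ : Algebra (MvPolynomial (Fin fs.length) K) B := (π.comp (aeval fs.get)).toRingHom.toAlgebra
  have hsmul (a : MvPolynomial (Fin fs.length) K) (x : MvPolynomial σ K) :
      a • π x = π (aeval fs.get a * x) := (map_mul π _ _).symm
  have halg (a : MvPolynomial (Fin fs.length) K) :
      algebraMap (MvPolynomial (Fin fs.length) K) B a = π (aeval fs.get a) := rfl
  have : Module.Finite (MvPolynomial (Fin fs.length) K) B := hfin
  have : FaithfulSMul (MvPolynomial (Fin fs.length) K) B :=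
    (faithfulSMul_iff_algebraMap_injective _ _).2 hinj
  obtain ⟨b, t, hb⟩ := exists_prod_pow_smul_notMem (K := K) (d := fs.length) B
  obtain ⟨b, rfl⟩ := hπ b
  refine ⟨b, t, fun s hs => hb s ?_⟩
  have hprod : aeval fs.get ((∏ i, X i : MvPolynomial (Fin fs.length) K) ^ s) = fs.prod ^ s := by
    rw [map_pow, map_prod]
    simp [← List.prod_ofFn]
  rw [hsmul, hprod, Ideal.smul_top_eq_map, Submodule.restrictScalars_mem]
  obtain ⟨x, hx, y, hy, hxy⟩ := Submodule.mem_sup.1 hs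
  rw [← hxy, map_add, (RingHom.mem_ker).1 hy, add_zero]
  refine (?_ : powIdeal fs (s + t) ≤ (Ideal.map _ _).comap π) hx
  refine Ideal.span_le.2 ?_
  rintro _ ⟨f, hf, rfl⟩
  obtain ⟨i, rfl⟩ := List.mem_iff_get.1 hf
  have h4 : π (fs.get i ^ (s + t)) = algebraMap (MvPolynomial (Fin fs.length) K) B
      (X i ^ (s + t)) := by
    rw [halg, map_pow (aeval fs.get), aeval_X]
  have h5 := Ideal.mem_map_of_mem (algebraMap (MvPolynomial (Fin fs.length) K) B)
    (Ideal.subset_span (Set.mem_range_self (f := fun i => X i ^ (s + t)) i))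
  rw [← h4] at h5
  exact h5

theorem exists_parameters_prod_pow_mul_notMem [Finite σ] {I : Ideal (MvPolynomial σ K)}
    (hI : I.IsHomogeneous (homogeneousSubmodule σ K)) (hne : I ≠ ⊤) :
    ∃ fs : List (MvPolynomial σ K), (∀ f ∈ fs, ∃ e, 0 < e ∧ f.IsHomogeneous e) ∧
      idealOfVars σ K ≤ (I ⊔ Ideal.span {f | f ∈ fs}).radical ∧
      ∃ (b : MvPolynomial σ K) (t : ℕ), ∀ s, fs.prod ^ s * b ∉ powIdeal fs (s + t) ⊔ I := by
  have hdim : ringKrullDim (MvPolynomial σ K ⧸ I) < (Nat.card σ + 1 : ℕ) := by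
    refine lt_of_le_of_lt (ringKrullDim_quotient_le I) ?_
    rw [MvPolynomial.ringKrullDim_of_isNoetherianRing, ringKrullDim_eq_zero_of_field, zero_add]
    exact_mod_cast Nat.lt_succ_self _
  obtain ⟨fs, h1, h2, h3⟩ := exists_homogeneous_parameters _ I hI hne hdim
  have hker : RingHom.ker (Ideal.Quotient.mkₐ K I) = I := Ideal.Quotient.mkₐ_ker K I
  have h4 := exists_prod_pow_mul_notMem (Ideal.Quotient.mkₐ K I)
    (Ideal.Quotient.mkₐ_surjective K I) (by rwa [hker]) h1 (by rwa [hker]) h3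
  rw [hker] at h4
  exact ⟨fs, h1, h2, h4⟩

end MvPolynomial

/-! ### Bigraded primes: grade, parameters and cohomological dimension. -/

section Bigraded

open MvPolynomial

variable {K : Type u} [Field K] {m n : ℕ}

theorem cohomDimLT_idealQ (N : Type u) [AddCommGroup N] [Module (MvPolynomial (Fin m ⊕ Fin n) K) N] :
    CohomDimLT (idealQ K m n) (n + 1) N := by
  intro i hi
  refine LocalCohomologyVanishes.of_length_lt (F := ∅)
    (gs := List.ofFn fun j : Fin n => X (Sum.inr j)) ?_ ?_ ?_ ?_
  · intro g hg
    obtain ⟨j, rfl⟩ := List.mem_ofFn.1 hg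
    exact Ideal.subset_span ⟨j, rfl⟩
  · refine le_trans ?_ Ideal.le_radical
    refine Ideal.span_mono ?_
    rintro _ ⟨j, rfl⟩
    exact Or.inr (List.mem_ofFn.2 ⟨j, rfl⟩)
  · rintro f ⟨⟩
  · simpa using hi

variable (K m n) in
/-- The endomorphism of `K[x, y]` that sends `x` to `0` and fixes `y`. -/
noncomputable def killX : MvPolynomial (Fin m ⊕ Fin n) K →ₐ[K] MvPolynomial (Fin n) K :=
  aeval (Sum.elim 0 X)

variable (K m n) in
/-- The inclusion of `K[y]` into `K[x, y]`. -/
noncomputable def includeY : MvPolynomial (Fin n) K →ₐ[K] MvPolynomial (Fin m ⊕ Fin n) K :=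
  rename Sum.inr

theorem killX_includeY (f : MvPolynomial (Fin n) K) : killX K m n (includeY K m n f) = f := by
  rw [killX, includeY, aeval_rename]
  exact aeval_X_left_apply f

theorem includeY_killX_monomial (μ : Fin m ⊕ Fin n →₀ ℕ) (a : K) :
    includeY K m n (killX K m n (monomial μ a)) =
      if (Finsupp.weight (bidegree m n) μ).1 = 0 then monomial μ a else 0 := by
  have hw : (Finsupp.weight (bidegree m n) μ).1 = ∑ i, (μ (Sum.inl i) : ℤ) := by
    simp [Finsupp.weight_apply, Finsupp.sum_fintype, Fintype.sum_sum_type, bidegree,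
      Prod.fst_sum, -nsmul_eq_mul]
  have h1 : includeY K m n (killX K m n (monomial μ a)) =
      C a * μ.prod fun i k => (Sum.elim 0 (X ∘ Sum.inr) i : MvPolynomial (Fin m ⊕ Fin n) K) ^ k := by
    rw [killX, includeY, aeval_monomial, map_mul, algebraMap_eq, rename_C,
      Finsupp.prod, map_prod, Finsupp.prod]
    congr 1
    refine Finset.prod_congr rfl fun i _ => ?_
    rcases i with i | j <;> simp
  rw [h1]
  split_ifs with h <;> rw [hw, Finset.sum_eq_zero_iff_of_nonneg (by simp)] at h
  · rw [monomial_eq]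
    congr 1
    refine Finsupp.prod_congr fun i hi => ?_
    rcases i with i | j
    · simp at h hi
      exact absurd (h i) hi
    · rfl
  · obtain ⟨i, hi⟩ : ∃ i, μ (Sum.inl i) ≠ 0 := by
      by_contra! H
      exact h (by simpa using H)
    rw [Finsupp.prod, Finset.prod_eq_zero (i := Sum.inl i) (by simpa using hi) (by simpa using hi),
      mul_zero]

theorem includeY_killX_of_isWeightedHomogeneous {x : MvPolynomial (Fin m ⊕ Fin n) K} {c : ℤ × ℤ}
    (hx : IsWeightedHomogeneous (bidegree m n) x c) :
    includeY K m n (killX K m n x) = if c.1 = 0 then x else 0 := by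
  conv_lhs => rw [x.as_sum]
  rw [map_sum, map_sum, Finset.sum_congr rfl fun μ hμ => by
    rw [includeY_killX_monomial, hx (mem_support_iff.1 hμ)]]
  split_ifs
  · exact x.as_sum.symm
  · simp

/-- The composite is the projection onto the part of x-degree zero, which preserves bigraded ideals.
Hence setting x = 0 maps p into p ∩ K[y]. -/
theorem includeY_killX_mem {p : Ideal (MvPolynomial (Fin m ⊕ Fin n) K)}
    (hp : ∀ x ∈ p, ∀ c, weightedHomogeneousComponent (bidegree m n) c x ∈ p)
    {x : MvPolynomial (Fin m ⊕ Fin n) K} (hx : x ∈ p) : includeY K m n (killX K m n x) ∈ p := by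
  have h := finsum_weightedHomogeneousComponent (bidegree m n) x
  rw [finsum_eq_sum _ (weightedHomogeneousComponent_finsupp x)] at h
  rw [← h, map_sum, map_sum]
  refine Ideal.sum_mem _ fun c _ => ?_
  rw [includeY_killX_of_isWeightedHomogeneous
    (weightedHomogeneousComponent_isWeightedHomogeneous _ _)]
  split_ifs
  · exact hp x hx c
  · exact zero_mem _

attribute [local instance] MvPolynomial.gradedAlgebra in
theorem isHomogeneous_comap_includeY {p : Ideal (MvPolynomial (Fin m ⊕ Fin n) K)}
    (hp : ∀ x ∈ p, ∀ c, weightedHomogeneousComponent (bidegree m n) c x ∈ p) :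
    (p.comap (includeY K m n)).IsHomogeneous (homogeneousSubmodule (Fin n) K) := by
  intro k f hf
  have h1 : (DirectSum.decompose (homogeneousSubmodule (Fin n) K) f k : MvPolynomial (Fin n) K) =
      homogeneousComponent k f := by
    rw [← decomposition.decompose'_apply]; rfl
  rw [h1, Ideal.mem_comap]
  have h2 : includeY K m n (homogeneousComponent k f) =
      weightedHomogeneousComponent (bidegree m n) (0, (k : ℤ)) (includeY K m n f) := by
    clear h1 hf
    induction f using MvPolynomial.induction_on' with
    | add f g hf hg => simp only [map_add, hf, hg]
    | monomial μ a =>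
      rw [includeY, homogeneousComponent_of_mem (isHomogeneous_monomial a rfl), rename_monomial,
        weightedHomogeneousComponent_of_mem (n := (0, (μ.degree : ℤ)))]
      · simp only [Prod.mk.injEq, true_and, Nat.cast_inj]
        split_ifs <;> simp [rename_monomial]
      · refine isWeightedHomogeneous_monomial _ _ _ ?_
        rw [Finsupp.weight_apply, Finsupp.sum_mapDomain_index (by simp) (by simp [add_mul])]
        simp [Finsupp.sum_fintype, bidegree, Prod.ext_iff, Finsupp.degree_eq_sum,
          Prod.fst_sum, Prod.snd_sum, -nsmul_eq_mul]
  rw [h2]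
  exact hp _ hf _

theorem includeY_mem_idealQ {f : MvPolynomial (Fin n) K} (hf : f ∈ idealOfVars (Fin n) K) :
    includeY K m n f ∈ idealQ K m n := by
  refine (Ideal.span_le.2 ?_ : idealOfVars (Fin n) K ≤ (idealQ K m n).comap (includeY K m n)) hf
  rintro _ ⟨j, rfl⟩
  exact Ideal.subset_span ⟨j, by simp [includeY]⟩

theorem powIdeal_map {R R' : Type*} [CommRing R] [CommRing R'] (φ : R →+* R') (gs : List R)
    (k : ℕ) : powIdeal (gs.map φ) k = (powIdeal gs k).map φ := by
  rw [powIdeal, powIdeal, Ideal.map_span]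
  congr 1
  ext x
  simp

/-- For a bihomogeneous prime `p` there is a number `d` (the length of a system of parameters
modulo `p + (x)`) that bounds `cd(Q, S/p)` from below, and the grade of every finitely generated
module with associated prime `p` from above. -/
theorem exists_parameter_number {p : Ideal (MvPolynomial (Fin m ⊕ Fin n) K)} (hprime : p.IsPrime)
    (hp : ∀ x ∈ p, ∀ c, weightedHomogeneousComponent (bidegree m n) c x ∈ p) :
    ∃ d : ℕ, ¬ CohomDimLT (idealQ K m n) d (MvPolynomial (Fin m ⊕ Fin n) K ⧸ p) ∧
      ∀ (N : Type u) [AddCommGroup N] [Module (MvPolynomial (Fin m ⊕ Fin n) K) N]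
        [Module.Finite (MvPolynomial (Fin m ⊕ Fin n) K) N],
        p ∈ associatedPrimes (MvPolynomial (Fin m ⊕ Fin n) K) N →
        ∀ rs : List (MvPolynomial (Fin m ⊕ Fin n) K), (∀ r ∈ rs, r ∈ idealQ K m n) →
          RingTheory.Sequence.IsWeaklyRegular N rs → rs.length ≤ d := by
  classical
  have hhom := isHomogeneous_comap_includeY hp
  have hne : p.comap (includeY K m n) ≠ ⊤ := Ideal.comap_ne_top _ hprime.ne_top
  obtain ⟨fs, hfs, hrad, b, t, hbt⟩ := exists_parameters_prod_pow_mul_notMem hhom hne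
  have hfsm (f) (hf : f ∈ fs) : f ∈ idealOfVars (Fin n) K := by
    obtain ⟨e, he, hfe⟩ := hfs f hf
    rw [mem_idealOfVars_iff_coeff]
    exact hfe.coeff_eq_zero (by simpa using he.ne)
  let gs := fs.map (includeY K m n : MvPolynomial (Fin n) K →+* MvPolynomial (Fin m ⊕ Fin n) K)
  have hgsfs : gs.map (killX K m n : MvPolynomial (Fin m ⊕ Fin n) K →+* MvPolynomial (Fin n) K) =
      fs := by
    simp [gs, Function.comp_def, killX_includeY]
  have hgs (g) (hg : g ∈ gs) : g ∈ idealQ K m n := by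
    obtain ⟨f, hf, rfl⟩ := List.mem_map.1 hg
    exact includeY_mem_idealQ (hfsm f hf)
  have hQ : idealQ K m n ≤ (p ⊔ Ideal.span {g | g ∈ gs}).radical := by
    refine Ideal.span_le.2 ?_
    rintro _ ⟨j, rfl⟩
    obtain ⟨k, hk⟩ := hrad (Ideal.subset_span ⟨j, rfl⟩ : X j ∈ idealOfVars (Fin n) K)
    refine ⟨k, ?_⟩
    have h1 := Ideal.mem_map_of_mem (includeY K m n) hk
    rw [Ideal.map_sup, Ideal.map_span, map_pow, includeY, rename_X] at h1
    suffices hle : Ideal.span ((rename Sum.inr : MvPolynomial (Fin n) K →ₐ[K]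
        MvPolynomial (Fin m ⊕ Fin n) K) '' {f | f ∈ fs}) ≤ Ideal.span {g | g ∈ gs} from
      sup_le (Ideal.map_comap_le.trans le_sup_left) (hle.trans le_sup_right) h1
    refine Ideal.span_mono ?_
    rintro _ ⟨f, hf, rfl⟩
    exact List.mem_map.2 ⟨f, hf, rfl⟩
  refine ⟨gs.length, fun h => ?_, fun N _ _ _ hN rs hrs h => ?_⟩
  -- Vanishing passes from S/p to its quotient S/J. The resulting membership maps under x ↦ 0 to one
  -- modulo p ∩ K[y], which the choice of b and t excludes.
  · let J := p ⊔ RingHom.ker (killX K m n)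
    have hJ : CohomDimLT (idealQ K m n) gs.length (MvPolynomial (Fin m ⊕ Fin n) K ⧸ J) := by
      refine CohomDimLT.of_support_subset (fun N _ _ => cohomDimLT_idealQ N) h ?_
      exact Module.support_subset_of_surjective
        (Submodule.factor (le_sup_left : p ≤ J)) (Submodule.factor_surjective _)
    have hJF : IsPowTorsion (J : Set (MvPolynomial (Fin m ⊕ Fin n) K))
        (MvPolynomial (Fin m ⊕ Fin n) K ⧸ J) := by
      intro f hf x
      obtain ⟨x, rfl⟩ := Ideal.Quotient.mk_surjective x
      exact ⟨1, by
        rw [pow_one]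
        exact Ideal.Quotient.eq_zero_iff_mem.2 (J.mul_mem_right x hf)⟩
    obtain ⟨s, hs⟩ := LocalCohomologyVanishes.exists_prod_pow_smul_mem hgs (hQ.trans
      (Ideal.radical_mono (sup_le (fun x hx => Ideal.subset_span
        (Or.inl (le_sup_left (a := p) hx))) (Ideal.span_mono fun x hx => Or.inr hx))))
      hJF (hJ _ le_rfl) (Ideal.Quotient.mk J (includeY K m n b)) t
    rw [Ideal.smul_top_eq_map, Submodule.restrictScalars_mem] at hs
    have hs' : gs.prod ^ s * includeY K m n b ∈ powIdeal gs (s + t) ⊔ J :=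
      Ideal.mem_quotient_iff_mem_sup.1 hs
    refine hbt s ?_
    have h1 := Ideal.mem_map_of_mem
      (killX K m n : MvPolynomial (Fin m ⊕ Fin n) K →+* MvPolynomial (Fin n) K) hs'
    rw [map_mul, map_pow, map_list_prod, hgsfs, Ideal.map_sup, ← powIdeal_map, hgsfs] at h1
    rw [RingHom.coe_coe, killX_includeY] at h1
    suffices hle : J.map (killX K m n : MvPolynomial (Fin m ⊕ Fin n) K →+* MvPolynomial (Fin n) K) ≤
        p.comap (includeY K m n) from sup_le le_sup_left (hle.trans le_sup_right) h1
    rw [Ideal.map_le_iff_le_comap]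
    refine sup_le (fun x hx => includeY_killX_mem hp hx) fun x hx => ?_
    rw [Ideal.mem_comap, RingHom.coe_coe, RingHom.mem_ker.1 hx]
    exact zero_mem _
  · have hspan : Ideal.span {g | g ∈ gs} = Ideal.span (gs.toFinset : Set _) := by
      simp
    have hne' : p ⊔ Ideal.span (gs.toFinset : Set _) ≠ ⊤ := by
      intro htop
      rw [← hspan] at htop
      have hle : p ⊔ Ideal.span {g | g ∈ gs} ≤ (idealOfVars (Fin n) K).comap
          (killX K m n : MvPolynomial (Fin m ⊕ Fin n) K →+* MvPolynomial (Fin n) K) := by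
        refine sup_le (fun x hx => le_idealOfVars_of_isHomogeneous hhom hne
          (includeY_killX_mem hp hx)) (Ideal.span_le.2 fun g hg => ?_)
        obtain ⟨f, hf, rfl⟩ := List.mem_map.1 hg
        simpa [killX_includeY] using hfsm f hf
      have := hle (htop ▸ Submodule.mem_top : (1 : MvPolynomial (Fin m ⊕ Fin n) K) ∈ _)
      rw [Ideal.mem_comap, map_one] at this
      exact isMaximal_idealOfVars.ne_top ((Ideal.eq_top_iff_one _).2 this)
    -- Q lies in the radical of p plus the parameters, so P contains Q and every regular sequence in
    -- Q.
    obtain ⟨P, hP⟩ := Ideal.nonempty_minimalPrimes hne'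
    refine (length_le_of_isWeaklyRegular hN hP (fun r hr => ?_) h).trans (List.toFinset_card_le _)
    exact hP.1.1.radical_le_iff.2 (hspan ▸ hP.1.2) (hQ (hrs r hr))

end Bigraded

/-! ### Numerical form of cohomological dimension and grade. -/

theorem cohomDim_lt_natCast_iff {R : Type u} [CommRing R] {I : Ideal R} {M : Type u}
    [AddCommGroup M] [Module R M] {d : ℕ} : cohomDim I M < (d : WithBot ℕ∞) ↔ CohomDimLT I d M := by
  have hnt (i : ℕ) : Nontrivial ((localCohomology I i).obj (ModuleCat.of R M)) ↔
      ¬ LocalCohomologyVanishes I i M := by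
    rw [← localCohomology_subsingleton_iff, not_subsingleton_iff_nontrivial]
  simp only [cohomDim, hnt, WithBot.coe_natCast]
  refine ⟨fun h i hi => ?_, fun h => ?_⟩
  · by_contra hV
    have h1 := (le_iSup₂ (f := fun (i : ℕ) (_ : ¬ LocalCohomologyVanishes I i M) =>
      (i : WithBot ℕ∞)) i hV).trans_lt h
    exact absurd (Nat.cast_lt.1 h1) hi.not_gt
  · have hlt (i : ℕ) (hi : ¬ LocalCohomologyVanishes I i M) : i < d := by
      by_contra hd
      exact hi (h i (not_lt.1 hd))
    cases d with
    | zero =>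
      refine lt_of_le_of_lt (b := ⊥) (iSup₂_le fun i hi => absurd (hlt i hi) (Nat.not_lt_zero i)) ?_
      exact WithBot.bot_lt_coe _
    | succ d =>
      rw [Nat.cast_succ, ENat.WithBot.lt_add_one_iff]
      exact iSup₂_le fun i hi => Nat.cast_le.2 (Nat.lt_succ_iff.1 (hlt i hi))

theorem cohomDim_eq_natCast_iff {R : Type u} [CommRing R] {I : Ideal R} {M : Type u}
    [AddCommGroup M] [Module R M] {d : ℕ} :
    cohomDim I M = (d : WithBot ℕ∞) ↔ CohomDimLT I (d + 1) M ∧ ¬ CohomDimLT I d M := by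
  rw [← cohomDim_lt_natCast_iff, ← cohomDim_lt_natCast_iff, Nat.cast_succ,
    ENat.WithBot.lt_add_one_iff, not_lt, le_antisymm_iff]

theorem CohomDimLT.mono {R : Type u} [CommRing R] {I : Ideal R} {M : Type u}
    [AddCommGroup M] [Module R M] {d e : ℕ} (h : CohomDimLT I d M) (hde : d ≤ e) :
    CohomDimLT I e M := fun i hi => h i (hde.trans hi)

theorem gradeOn_le_natCast_iff {R : Type u} [CommRing R] {I : Ideal R} {M : Type u}
    [AddCommGroup M] [Module R M] {d : ℕ} :
    gradeOn I M ≤ d ↔ ∀ rs : List R, (∀ r ∈ rs, r ∈ I) →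
      RingTheory.Sequence.IsWeaklyRegular M rs → rs.length ≤ d := by
  simp [gradeOn]

theorem Submodule.IsHomogeneous.sSup {R M ι : Type*} [CommRing R] [AddCommGroup M] [Module R M]
    [DecidableEq ι] {ℳ : ι → AddSubgroup M} [DirectSum.Decomposition ℳ] {s : Set (Submodule R M)}
    (h : ∀ N ∈ s, N.IsHomogeneous ℳ) : (sSup s).IsHomogeneous ℳ := by
  intro i x hx
  rw [sSup_eq_iSup'] at hx ⊢
  induction hx using Submodule.iSup_induction' with
  | mem N x hx => exact Submodule.mem_iSup_of_mem N (h N.1 N.2 i hx)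
  | zero => rw [DirectSum.decompose_zero]; exact zero_mem _
  | add x y _ _ hx hy => rw [DirectSum.decompose_add]; exact add_mem hx hy

/-! ### Associated primes of bigraded modules are bigraded. -/

section

open MvPolynomial

variable {K : Type u} [Field K] {m n : ℕ} {M : Type*} [AddCommGroup M]
  [Module (MvPolynomial (Fin m ⊕ Fin n) K) M] {ℳ : ℤ × ℤ → AddSubgroup M}
  [DirectSum.Decomposition ℳ] [SetLike.GradedSMul (bigrading K m n) ℳ]

theorem decompose_smul_of_isWeightedHomogeneous {a : MvPolynomial (Fin m ⊕ Fin n) K} {c : ℤ × ℤ}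
    (ha : IsWeightedHomogeneous (bidegree m n) a c) (x : M) (d : ℤ × ℤ) :
    (DirectSum.decompose ℳ (a • x) d : M) = a • (DirectSum.decompose ℳ x (d - c) : M) := by
  induction x using DirectSum.Decomposition.inductionOn ℳ with
  | zero => simp
  | add x y hx hy => 
    rw [smul_add, DirectSum.decompose_add, DirectSum.decompose_add, DirectSum.add_apply,
      DirectSum.add_apply, AddSubgroup.coe_add, AddSubgroup.coe_add, hx, hy, smul_add]
  | @homogeneous e x =>
    have hax : a • (x : M) ∈ ℳ (c + e) :=
      SetLike.GradedSMul.smul_mem (A := bigrading K m n) ha x.2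
    by_cases hd : c + e = d
    · subst hd
      rw [DirectSum.decompose_of_mem_same ℳ hax, add_sub_cancel_left,
        DirectSum.decompose_of_mem_same ℳ x.2]
    · rw [DirectSum.decompose_of_mem_ne ℳ hax hd, DirectSum.decompose_of_mem_ne ℳ x.2, smul_zero]
      rintro rfl
      exact hd (add_sub_cancel c d)

/-- A prime ideal of the form `(U : x)`, with `U` a bigraded submodule, is bigraded. -/
theorem weightedHomogeneousComponent_mem_of_colon {U : Submodule (MvPolynomial (Fin m ⊕ Fin n) K) M}
    (hU : U.IsHomogeneous ℳ) {p : Ideal (MvPolynomial (Fin m ⊕ Fin n) K)} (hp : p.IsPrime) (x : M)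
    (hpx : ∀ a, a ∈ p ↔ a • x ∈ U) :
    ∀ a ∈ p, ∀ c, weightedHomogeneousComponent (bidegree m n) c a ∈ p := by
  classical
  let S (x : M) : Set (ℤ × ℤ) := {d | (DirectSum.decompose ℳ x d : M) ∉ U}
  have hS (x : M) : (S x).Finite := by
    refine (DFinsupp.finite_support (DirectSum.decompose ℳ x)).subset fun d hd h => hd ?_
    rw [h]
    exact zero_mem U
  obtain ⟨N, hN⟩ : ∃ N, (S x).ncard = N := ⟨_, rfl⟩
  -- Induction on the number of components of x outside U. With d and c lexicographically maximal
  -- among the bad degrees of x and a, the degree d + c part of ax shows a_c x_d ∈ U. Then x is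
  -- replaced by a_c x, which has fewer bad components and, as a_c ∉ p, the same colon ideal.
  induction N using Nat.strong_induction_on generalizing x with
  | _ N ih =>
    intro a ha
    by_contra! H
    have hx : x ∉ U := fun h => hp.ne_top ((Ideal.eq_top_iff_one p).2 ((hpx 1).2 (by simpa)))
    have hSx : (S x).Nonempty := by
      by_contra! h
      refine hx ((Submodule.IsHomogeneous.mem_iff ℳ hU).2 fun d => ?_)
      by_contra hd
      exact (h ▸ hd : d ∈ (∅ : Set (ℤ × ℤ)))
    obtain ⟨d, hd, hdmax⟩ := Set.exists_max_image _ toLex (hS x) hSx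
    have hafin := weightedHomogeneousComponent_finsupp (w := bidegree m n) a
    have hne (c) (hc : weightedHomogeneousComponent (bidegree m n) c a ∉ p) :
        weightedHomogeneousComponent (bidegree m n) c a ≠ 0 := fun h => hc (h ▸ zero_mem p)
    have hTfin : {c | weightedHomogeneousComponent (bidegree m n) c a ∉ p}.Finite :=
      hafin.subset hne
    obtain ⟨c, hc, hcmax⟩ := Set.exists_max_image _ toLex hTfin H
    have hhom (c) := weightedHomogeneousComponent_isWeightedHomogeneous (w := bidegree m n) c a
    have hcd : weightedHomogeneousComponent (bidegree m n) c a •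
        (DirectSum.decompose ℳ x d : M) ∈ U := by
      have hsum := finsum_weightedHomogeneousComponent (bidegree m n) a
      rw [finsum_eq_sum _ hafin] at hsum
      have h1 : (DirectSum.decompose ℳ (a • x) (d + c) : M) ∈ U := hU _ ((hpx a).1 ha)
      rw [← hsum, Finset.sum_smul, DirectSum.decompose_sum, DFinsupp.finsetSum_apply,
        AddSubgroup.val_finsetSum] at h1
      rw [← Finset.add_sum_erase (a := c) _ _ (hafin.mem_toFinset.2 (hne c hc)),
        Submodule.add_mem_iff_left, decompose_smul_of_isWeightedHomogeneous (hhom c),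
        add_sub_cancel_right] at h1
      · exact h1
      · refine Submodule.sum_mem _ fun c' hc' => ?_
        by_cases hc'p : weightedHomogeneousComponent (bidegree m n) c' a ∈ p
        · exact hU _ ((hpx _).1 hc'p)
        · have hlt : toLex c' < toLex c := lt_of_le_of_ne (hcmax c' hc'p)
            fun h => (Finset.mem_erase.1 hc').1 (toLex.injective h)
          rw [decompose_smul_of_isWeightedHomogeneous (hhom c')]
          refine U.smul_mem _ ?_
          by_contra hmem
          have h2 := hdmax _ hmem
          have h3 : toLex d < toLex (d + c - c') := by
            rw [Prod.Lex.toLex_lt_toLex] at hlt ⊢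
            simp only [Prod.fst_add, Prod.fst_sub, Prod.snd_add, Prod.snd_sub]
            omega
          exact h3.not_ge h2
    refine hc (ih (S (weightedHomogeneousComponent (bidegree m n) c a • x)).ncard ?_
      (weightedHomogeneousComponent (bidegree m n) c a • x) (fun b => ?_) rfl a ha c)
    · rw [← hN]
      have hsub : S (weightedHomogeneousComponent (bidegree m n) c a • x) ⊆
          (· + c) '' (S x \ {d}) := by
        intro e he
        have he' : (DirectSum.decompose ℳ (weightedHomogeneousComponent (bidegree m n) c a • x) e :
          M) ∉ U := he
        rw [decompose_smul_of_isWeightedHomogeneous (hhom c)] at he'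
        refine ⟨e - c, ⟨fun h => he' (U.smul_mem _ h), ?_⟩, sub_add_cancel e c⟩
        rintro rfl
        exact he' hcd
      calc _ ≤ ((· + c) '' (S x \ {d})).ncard :=
            Set.ncard_le_ncard hsub (((hS x).sdiff).image _)
        _ ≤ (S x \ {d}).ncard := Set.ncard_image_le (hS x).sdiff
        _ < (S x).ncard := Set.ncard_sdiff_singleton_lt_of_mem hd (hS x)
    · rw [smul_smul, ← hpx]
      exact ⟨fun h => p.mul_mem_right _ h, fun h => (hp.mem_or_mem h).resolve_right hc⟩

end

/-! ### The unmixed component and associated primes of its quotient. -/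

theorem mem_support_of_mem_associatedPrimes {R M : Type*} [CommRing R] [IsNoetherianRing R]
    [AddCommGroup M] [Module R M] [Module.Finite R M] {p : Ideal R}
    (hp : p ∈ associatedPrimes R M) : (⟨p, hp.1⟩ : PrimeSpectrum R) ∈ Module.support R M := by
  rw [Module.mem_support_iff_of_finite, ← Submodule.annihilator_top]
  exact IsAssociatedPrime.annihilator_le hp

section

variable {R : Type u} [CommRing R] [IsNoetherianRing R] {I : Ideal R} {D : ℕ}
  {M : Type u} [AddCommGroup M] [Module R M] [Module.Finite R M]

theorem CohomDimLT.sup (hD : ∀ (N : Type u) [AddCommGroup N] [Module R N], CohomDimLT I D N) {d : ℕ} {N N' : Submodule R M} (h : CohomDimLT I d N)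
    (h' : CohomDimLT I d N') : CohomDimLT I d ↥(N ⊔ N') := by
  have hprod : CohomDimLT I d (N × N') := fun i hi =>
    LocalCohomologyVanishes.of_exact (f := LinearMap.inl R N N') (g := LinearMap.snd R N N')
      LinearMap.inl_injective .inl_snd LinearMap.snd_surjective (h i hi) (h' i hi)
  refine CohomDimLT.of_support_subset hD hprod (Module.support_subset_of_surjective
    ((Submodule.inclusion le_sup_left).coprod (Submodule.inclusion le_sup_right)) ?_)
  rintro ⟨x, hx⟩
  obtain ⟨y, hy, z, hz, rfl⟩ := Submodule.mem_sup.1 hx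
  exact ⟨(⟨y, hy⟩, ⟨z, hz⟩), rfl⟩

theorem CohomDimLT.quotient_of_mem_associatedPrimes
    (hD : ∀ (N : Type u) [AddCommGroup N] [Module R N], CohomDimLT I D N) {d : ℕ}
    (h : CohomDimLT I d M) {p : Ideal R} (hp : p ∈ associatedPrimes R M) :
    CohomDimLT I d (R ⧸ p) :=
  CohomDimLT.quotient_of_mem_support hD h (p := ⟨p, hp.1⟩) (mem_support_of_mem_associatedPrimes hp)

/-- The submodules in question are closed under binary sums, since a sum is a quotient of the
product. In a Noetherian module a maximal one is therefore the largest, and the supremum is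
attained. -/
theorem unmixedComponent_mem
    (hD : ∀ (N : Type u) [AddCommGroup N] [Module R N], CohomDimLT I D N) (ℳ : ℤ × ℤ → AddSubgroup M) [DirectSum.Decomposition ℳ] {c : ℕ}
    (hc : cohomDim I M = c) : (unmixedComponent I ℳ).IsHomogeneous ℳ ∧
      CohomDimLT I c (unmixedComponent I ℳ) := by
  refine ⟨Submodule.IsHomogeneous.sSup fun N hN => hN.1, ?_⟩
  rw [unmixedComponent, hc]
  let s : Set (Submodule R M) := {N | N.IsHomogeneous ℳ ∧ CohomDimLT I c N}
  have hs : {N : Submodule R M | N.IsHomogeneous ℳ ∧ cohomDim I N < (c : WithBot ℕ∞)} = s := by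
    ext N
    exact and_congr_right fun _ => cohomDim_lt_natCast_iff
  rw [hs]
  have hbot : ⊥ ∈ s := ⟨fun i x hx => by
    rw [(Submodule.mem_bot R).1 hx, DirectSum.decompose_zero]; exact zero_mem _,
    fun i _ => LocalCohomologyVanishes.of_subsingleton i⟩
  have hsup (N) (hN : N ∈ s) (N') (hN' : N' ∈ s) : N ⊔ N' ∈ s := by
    refine ⟨?_, CohomDimLT.sup hD hN.2 hN'.2⟩
    rw [← sSup_pair]
    refine Submodule.IsHomogeneous.sSup ?_
    rintro _ (rfl | rfl)
    exacts [hN.1, hN'.1]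
  obtain ⟨N, -, hN, hmax⟩ := exists_maximal_ge_of_wellFoundedGT (· ∈ s) ⊥ hbot
  have : sSup s = N := le_antisymm
    (sSup_le fun N' hN' => le_sup_right.trans (hmax (hsup N hN N' hN') le_sup_left)) (le_sSup hN)
  rw [this]
  exact hN.2

end

/-- Some s outside p kills U. If p is the annihilator of the class of x, it is also the annihilator
of sx in M. -/
theorem associatedPrimes_of_quotient_of_notMem_support {R M : Type*} [CommRing R]
    [IsNoetherianRing R] [AddCommGroup M] [Module R M] [Module.Finite R M] {U : Submodule R M}
    {p : Ideal R} (hp : p ∈ associatedPrimes R (M ⧸ U))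
    (hU : (⟨p, hp.1⟩ : PrimeSpectrum R) ∉ Module.support R U) : p ∈ associatedPrimes R M := by
  obtain ⟨hprime, y, hy⟩ := isAssociatedPrime_iff.1 hp
  obtain ⟨x, rfl⟩ := U.mkQ_surjective y
  rw [Module.mem_support_iff_of_finite] at hU
  obtain ⟨s, hs, hsp⟩ := SetLike.not_le_iff_exists.1 hU
  have hs' (u : M) (hu : u ∈ U) : s • u = 0 :=
    congrArg Subtype.val (Module.mem_annihilator.1 hs ⟨u, hu⟩)
  have hpx (a : R) : a ∈ p ↔ a • x ∈ U := by
    rw [hy, Submodule.mem_colon_singleton, ← map_smul, Submodule.mem_bot, Submodule.mkQ_apply,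
      Submodule.Quotient.mk_eq_zero]
  refine isAssociatedPrime_iff.2 ⟨hprime, s • x, ?_⟩
  ext a
  rw [Submodule.mem_colon_singleton, Submodule.mem_bot]
  refine ⟨fun ha => ?_, fun ha => (hprime.mem_or_mem ?_).resolve_right hsp⟩
  · rw [smul_comm]
    exact hs' _ ((hpx a).1 ha)
  · rw [hpx, mul_smul, ha]
    exact zero_mem U

section

open MvPolynomial

variable {K : Type u} [Field K] {m n : ℕ} {M : Type u} [AddCommGroup M]
  [Module (MvPolynomial (Fin m ⊕ Fin n) K) M] {ℳ : ℤ × ℤ → AddSubgroup M} [DirectSum.Decomposition ℳ] [SetLike.GradedSMul (bigrading K m n) ℳ]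

theorem weightedHomogeneousComponent_mem_of_mem_associatedPrimes_quotient
    {U : Submodule (MvPolynomial (Fin m ⊕ Fin n) K) M} (hU : U.IsHomogeneous ℳ)
    {p : Ideal (MvPolynomial (Fin m ⊕ Fin n) K)}
    (hp : p ∈ associatedPrimes (MvPolynomial (Fin m ⊕ Fin n) K) (M ⧸ U)) :
    ∀ a ∈ p, ∀ c, weightedHomogeneousComponent (bidegree m n) c a ∈ p := by
  obtain ⟨hprime, y, hy⟩ := isAssociatedPrime_iff.1 hp
  obtain ⟨x, rfl⟩ := U.mkQ_surjective y
  refine weightedHomogeneousComponent_mem_of_colon hU hprime x fun a => ?_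
  rw [hy, Submodule.mem_colon_singleton, ← map_smul, Submodule.mem_bot, Submodule.mkQ_apply,
    Submodule.Quotient.mk_eq_zero]

theorem weightedHomogeneousComponent_mem_of_mem_associatedPrimes
    {p : Ideal (MvPolynomial (Fin m ⊕ Fin n) K)}
    (hp : p ∈ associatedPrimes (MvPolynomial (Fin m ⊕ Fin n) K) M)
    (ℳ : ℤ × ℤ → AddSubgroup M) [DirectSum.Decomposition ℳ]
    [SetLike.GradedSMul (bigrading K m n) ℳ] :
    ∀ a ∈ p, ∀ c, weightedHomogeneousComponent (bidegree m n) c a ∈ p := by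
  obtain ⟨hprime, x, hx⟩ := isAssociatedPrime_iff.1 hp
  refine weightedHomogeneousComponent_mem_of_colon (U := ⊥) (ℳ := ℳ) (fun i y hy => ?_) hprime x
    fun a => ?_
  · rw [(Submodule.mem_bot _).1 hy, DirectSum.decompose_zero]
    exact zero_mem _
  · rw [hx, Submodule.mem_colon_singleton]

theorem exists_cohomDim_eq_natCast (h : cohomDim (idealQ K m n) M ≠ ⊥) :
    ∃ c : ℕ, cohomDim (idealQ K m n) M = c := by
  have h1 := cohomDim_lt_natCast_iff.2 (cohomDimLT_idealQ (K := K) (m := m) (n := n) M)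
  rw [Nat.cast_succ, ENat.WithBot.lt_add_one_iff] at h1
  generalize cohomDim (idealQ K m n) M = e at h h1
  induction e using WithBot.recBotCoe with
  | bot => exact absurd rfl h
  | coe e =>
    have h2 : e ≤ n := by exact_mod_cast h1
    lift e to ℕ using ne_top_of_le_ne_top (ENat.natCast_ne_top n) h2
    exact ⟨e, rfl⟩

end

/-! ### The squeeze between grade and cohomological dimension. -/

/-- The associated primes of `U` and `M ⧸ U` when `cd(I, U) < cd(I, M)`, `M ⧸ U` is Cohen–Macaulay
with respect to `I`, `grade(I, M) ≥ cd(I, M) - 1`, and the grades of `M` and `M ⧸ U` are bounded by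
the cohomological dimensions at their associated primes. -/
theorem associatedPrimes_eq_of_gradeOn_bounds {R : Type u} [CommRing R] [IsNoetherianRing R]
    {I : Ideal R} {D : ℕ}
    (hD : ∀ (N : Type u) [AddCommGroup N] [Module R N], CohomDimLT I D N)
    {M : Type u} [AddCommGroup M] [Module R M] [Module.Finite R M] {U : Submodule R M} {c : ℕ}
    (hc : cohomDim I M = c) (hU : CohomDimLT I c U) (hCM : IsCMWith I (M ⧸ U))
    (hgrade : (c : WithBot ℕ∞) ≤ (gradeOn I M : WithBot ℕ∞) + 1)
    (hQ : ∀ p ∈ associatedPrimes R (M ⧸ U),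
      ∃ d : ℕ, ¬ CohomDimLT I d (R ⧸ p) ∧ gradeOn I (M ⧸ U) ≤ d)
    (hA : ∀ p ∈ associatedPrimes R M, ∃ d : ℕ, ¬ CohomDimLT I d (R ⧸ p) ∧ gradeOn I M ≤ d) :
    associatedPrimes R U =
        {p | p ∈ associatedPrimes R M ∧ cohomDim I (R ⧸ p) + 1 = c} ∧
      associatedPrimes R (M ⧸ U) =
        {p | p ∈ associatedPrimes R M ∧ cohomDim I (R ⧸ p) = c} := by
  rw [IsCMWith] at hCM
  obtain ⟨hc1, hc0⟩ := cohomDim_eq_natCast_iff.1 hc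
  have hquot : CohomDimLT I (c + 1) (M ⧸ U) := CohomDimLT.of_support_subset hD hc1
    (Module.support_subset_of_surjective U.mkQ U.mkQ_surjective)
  have hquotc : cohomDim I (M ⧸ U) = c := by
    refine cohomDim_eq_natCast_iff.2 ⟨hquot, fun h => hc0 fun i hi => ?_⟩
    exact LocalCohomologyVanishes.of_exact U.subtype_injective (LinearMap.exact_subtype_mkQ U)
      U.mkQ_surjective (hU i hi) (h i hi)
  have hassU (p : Ideal R) (hp : p ∈ associatedPrimes R U) :
      CohomDimLT I c (R ⧸ p) :=
    CohomDimLT.quotient_of_mem_associatedPrimes hD hU hp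
  have hassQ (p : Ideal R) (hp : p ∈ associatedPrimes R (M ⧸ U)) :
      cohomDim I (R ⧸ p) = c := by
    obtain ⟨d, hd, h1⟩ := hQ p hp
    have h2 : c ≤ d := by
      have h3 : (gradeOn I (M ⧸ U) : WithBot ℕ∞) ≤ ((d : ℕ∞) : WithBot ℕ∞) :=
        WithBot.coe_le_coe.2 h1
      rw [hCM, hquotc, WithBot.coe_natCast] at h3
      exact Nat.cast_le.1 h3
    exact cohomDim_eq_natCast_iff.2 ⟨CohomDimLT.quotient_of_mem_associatedPrimes hD hquot hp, fun h => hd (h.mono h2)⟩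
  have hunion := associatedPrimes.subset_union_of_exact U.subtype_injective
    (LinearMap.exact_subtype_mkQ U)
  refine ⟨?_, ?_⟩
  · ext p
    refine ⟨fun hp => ?_, fun ⟨hp, hpc⟩ => (hunion hp).resolve_right fun h => ?_⟩
    · have hpM := associatedPrimes.subset_of_injective U.subtype_injective hp
      refine ⟨hpM, ?_⟩
      obtain ⟨d, hd, h1⟩ := hA p hpM
      have h2 : c ≤ d + 1 := by
        have h3 : (gradeOn I M : WithBot ℕ∞) ≤ ((d : ℕ∞) : WithBot ℕ∞) := WithBot.coe_le_coe.2 h1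
        rw [WithBot.coe_natCast] at h3
        have h4 : (c : WithBot ℕ∞) ≤ (d + 1 : ℕ) := by
          rw [Nat.cast_succ]
          exact hgrade.trans (by gcongr)
        exact Nat.cast_le.1 h4
      have h3 : d < c := by
        by_contra h
        exact hd ((hassU p hp).mono (not_lt.1 h))
      have h4 : c = d + 1 := by omega
      rw [cohomDim_eq_natCast_iff.2 ⟨h4 ▸ hassU p hp, hd⟩, h4, Nat.cast_succ]
    · rw [hassQ p h] at hpc
      rw [← Nat.cast_succ] at hpc
      exact absurd (Nat.cast_injective hpc) (Nat.succ_ne_self c)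
  · ext p
    refine ⟨fun hp => ⟨?_, hassQ p hp⟩, fun ⟨hp, hpc⟩ => (hunion hp).resolve_left fun h => ?_⟩
    · refine associatedPrimes_of_quotient_of_notMem_support hp fun h => ?_
      exact (cohomDim_eq_natCast_iff.1 (hassQ p hp)).2
        (CohomDimLT.quotient_of_mem_support hD hU (p := ⟨p, hp.1⟩) h)
    · exact (cohomDim_eq_natCast_iff.1 hpc).2 (hassU p h)

theorem mainTheorem12 {K : Type u} [Field K] (m n : ℕ)
    {M : Type u} [AddCommGroup M] [Module (MvPolynomial (Fin m ⊕ Fin n) K) M]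
    [Module.Finite (MvPolynomial (Fin m ⊕ Fin n) K) M]
    (ℳ : ℤ × ℤ → AddSubgroup M) [DirectSum.Decomposition ℳ]
    [SetLike.GradedSMul (bigrading K m n) ℳ]
    (hM : IsApproxCMWith (idealQ K m n) ℳ) :
    associatedPrimes (MvPolynomial (Fin m ⊕ Fin n) K) (unmixedComponent (idealQ K m n) ℳ) =
        {p | p ∈ associatedPrimes (MvPolynomial (Fin m ⊕ Fin n) K) M ∧
          cohomDim (idealQ K m n) (MvPolynomial (Fin m ⊕ Fin n) K ⧸ p) + 1 =
            cohomDim (idealQ K m n) M} ∧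
      associatedPrimes (MvPolynomial (Fin m ⊕ Fin n) K) (M ⧸ unmixedComponent (idealQ K m n) ℳ) =
        {p | p ∈ associatedPrimes (MvPolynomial (Fin m ⊕ Fin n) K) M ∧
          cohomDim (idealQ K m n) (MvPolynomial (Fin m ⊕ Fin n) K ⧸ p) =
            cohomDim (idealQ K m n) M} := by
  have hD (N : Type u) [AddCommGroup N] [Module (MvPolynomial (Fin m ⊕ Fin n) K) N] :
      CohomDimLT (idealQ K m n) (n + 1) N := cohomDimLT_idealQ N
  obtain ⟨hCM, hgrade⟩ := hM
  obtain ⟨c, hc⟩ : ∃ c : ℕ, cohomDim (idealQ K m n) M = c := by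
    -- If cd(Q, M) were `⊥`, so would be cd(Q, M/U); but it equals a grade, which is never `⊥`. In
    -- particular M = 0 does not satisfy the hypothesis.
    refine exists_cohomDim_eq_natCast fun h => ?_
    have h0 : CohomDimLT (idealQ K m n) 0 M :=
      cohomDim_lt_natCast_iff.1 (h ▸ WithBot.bot_lt_coe _)
    have h1 := cohomDim_lt_natCast_iff.2 (CohomDimLT.of_support_subset hD h0
      (Module.support_subset_of_surjective _
        (unmixedComponent (idealQ K m n) ℳ).mkQ_surjective))
    rw [← (show _ = _ from hCM)] at h1
    exact absurd (WithBot.coe_lt_coe.1 h1) not_lt_bot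
  obtain ⟨hUhom, hU⟩ := unmixedComponent_mem hD ℳ hc
  rw [hc] at hgrade ⊢
  refine associatedPrimes_eq_of_gradeOn_bounds hD hc hU hCM hgrade (fun p hp => ?_) fun p hp => ?_
  · obtain ⟨d, hd, hgr⟩ := exists_parameter_number hp.1
      (weightedHomogeneousComponent_mem_of_mem_associatedPrimes_quotient hUhom hp)
    exact ⟨d, hd, gradeOn_le_natCast_iff.2 (hgr _ hp)⟩
  · obtain ⟨d, hd, hgr⟩ := exists_parameter_number hp.1
      (weightedHomogeneousComponent_mem_of_mem_associatedPrimes hp ℳ)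
    exact ⟨d, hd, gradeOn_le_natCast_iff.2 (hgr _ hp)⟩
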